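/- Let $\Phi(t)=e^{|t|}-|t|-1$ and $\Psi(t)=(1+|t|)\log(1+|t|)-|t|$, and let $\Phi^{-1},\Psi^{-1}:[0,\infty)\to[0,\infty)$ denote the inverses of their restrictions to $[0,\infty)$. Let $f:\mathbb R\to\mathbb R$ be $2\pi$-periodic and Lebesgue measurable with $f\in L^\Psi$, i.e. $\int_{-\pi}^{\pi}\Psi(|f(t)|)\,dt<\infty$. For $x\in\mathbb R$ and $\delta>0$ put $\varphi_x(t)=f(x+t)+f(x-t)-2f(x)$ and $$w_xf(\delta)_\Psi=\Psi^{-1}\Big\{\frac1\delta\int_0^\delta\Psi(|\varphi_x(t)|)\,dt\Big\},$$ and call $x$ an $L^\Psi$-point of $f$ if $\lim_{n\to\infty}w_xf\big(\tfrac{\pi}{n+1}\big)_\Psi=0$. Let $S_\nu f$ be the $\nu$-th partial sum of the trigonometric Fourier series of $f$, and $$H_n^\Phi f(x)=\Phi^{-1}\Big\{\frac1{n+1}\sum_{\nu=0}^n\Phi\big(|S_\nu f(x)-f(x)|\big)\Big\}.$$ Then almost every $x\in\mathbb R$ is an $L^\Psi$-point of $f$. At every $L^\Psi$-point $x$ of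 $f$, and hence for almost every $x$, $$\sum_{k=0}^{n}\frac{\Psi'\big(\frac1{k+1}\big)}{(k+1)^{1/2}}\,\Psi\Big(w_xf\Big(\frac{\pi(k+1)}{n+1}\Big)_\Psi\Big)+(n+1)\,\Psi\Big(\frac1{n+1}\Big)\Psi\big(w_xf(\pi)_\Psi\big)\longrightarrow0\qquad(n\to\infty),$$ and $$H_n^\Phi f(x)\longrightarrow0\qquad(n\to\infty).$$ -/

import Mathlib

open Real Filter Topology MeasureTheory

noncomputable section

namespace StrongApprox

/-- The N-function `Φ(t) = e^{|t|} - |t| - 1`. -/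
def expPhi (t : ℝ) : ℝ := Real.exp |t| - |t| - 1

/-- The N-function `Ψ(t) = (1 + |t|) log (1 + |t|) - |t|`, complementary to `expPhi`. -/
def logPsi (t : ℝ) : ℝ := (1 + |t|) * Real.log (1 + |t|) - |t|

/-- The inverse on `[0, ∞)` of an N-function `Θ`: an N-function maps `[0, ∞)` bijectively onto
`[0, ∞)`, so for `y ≥ 0` this is the unique `u ≥ 0` with `Θ u = y`. -/
def nInv (Θ : ℝ → ℝ) (y : ℝ) : ℝ := Function.invFunOn Θ (Set.Ici 0) y

/-- The Orlicz class `L^Ψ`: the `2π`-periodic, real-valued, Lebesgue measurable functions `f` with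
`∫_{[-π, π]} Ψ(|f|) < ∞`. -/
structure MemLPsi (Ψ f : ℝ → ℝ) : Prop where
  periodic : Function.Periodic f (2 * π)
  aemeasurable : AEMeasurable f volume
  integrableOn : IntegrableOn (fun t => Ψ |f t|) (Set.Icc (-π) π) volume

/-- The Fourier cosine coefficient `a_k(f)`. -/
def cosCoeff (f : ℝ → ℝ) (k : ℕ) : ℝ := (1 / π) * ∫ t in (-π)..π, f t * Real.cos (k * t)

/-- The Fourier sine coefficient `b_k(f)`. -/
def sinCoeff (f : ℝ → ℝ) (k : ℕ) : ℝ := (1 / π) * ∫ t in (-π)..π, f t * Real.sin (k * t)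

/-- The partial sum `S_ν f(x) = a_0/2 + ∑_{k=1}^ν (a_k cos kx + b_k sin kx)`. -/
def partialSum (f : ℝ → ℝ) (ν : ℕ) (x : ℝ) : ℝ :=
  cosCoeff f 0 / 2 +
    ∑ k ∈ Finset.Icc 1 ν, (cosCoeff f k * Real.cos (k * x) + sinCoeff f k * Real.sin (k * x))

/-- The strong mean `H_n^Φ f(x) = Φ⁻¹ ((n+1)⁻¹ ∑_{ν=0}^n Φ(|S_ν f(x) - f(x)|))`. -/
def strongMean (Φ f : ℝ → ℝ) (n : ℕ) (x : ℝ) : ℝ :=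
  nInv Φ ((1 / ((n : ℝ) + 1)) * ∑ ν ∈ Finset.range (n + 1), Φ |partialSum f ν x - f x|)

/-- `φ_x(t) = f(x+t) + f(x-t) - 2 f(x)`. -/
def symmDiff₂ (f : ℝ → ℝ) (x t : ℝ) : ℝ := f (x + t) + f (x - t) - 2 * f x

/-- The pointwise modulus `w_x f(δ)_Ψ = Ψ⁻¹ (δ⁻¹ ∫_0^δ Ψ(|φ_x(t)|) dt)`. -/
def pointModulus (Ψ f : ℝ → ℝ) (x δ : ℝ) : ℝ :=
  nInv Ψ ((1 / δ) * ∫ t in (0 : ℝ)..δ, Ψ |symmDiff₂ f x t|)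

/-- `x` is an `L^Ψ`-point of `f`: `w_x f(π/(n+1))_Ψ → 0` as `n → ∞`. -/
def IsLPsiPoint (Ψ f : ℝ → ℝ) (x : ℝ) : Prop :=
  Tendsto (fun n : ℕ => pointModulus Ψ f x (π / ((n : ℝ) + 1))) atTop (𝓝 0)

/-- The characteristic
`∑_{k=0}^n Ψ'(1/(k+1)) (k+1)^{-1/2} Ψ(w_x f(π(k+1)/(n+1))_Ψ) + (n+1) Ψ(1/(n+1)) Ψ(w_x f(π)_Ψ)`. -/
def characteristic (Ψ f : ℝ → ℝ) (n : ℕ) (x : ℝ) : ℝ :=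
  (∑ k ∈ Finset.range (n + 1),
      deriv Ψ (1 / ((k : ℝ) + 1)) / Real.sqrt ((k : ℝ) + 1) *
        Ψ (pointModulus Ψ f x (π * ((k : ℝ) + 1) / ((n : ℝ) + 1)))) +
    ((n : ℝ) + 1) * Ψ (1 / ((n : ℝ) + 1)) * Ψ (pointModulus Ψ f x π)

end StrongApprox

end

/-!
At an `L^Ψ`-point the averages of `Ψ(|φ_x|)` over `[0, u]` are small for small `u`, and
`S_ν f(x) - f(x) = π⁻¹ ∫_0^π φ_x D_ν`. The part of this integral away from `0` vanishes as
`ν → ∞` by the Riemann–Lebesgue lemma. The part near `0` is cut at the nodes `kπ/N`: the `k`-th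
piece is at most `a_k`, a constant times the mean of `|φ_x|` over that interval divided by `k + 1`.
A large sieve inequality for the kernels `D_ν`, dualized, bounds the mean square over `ν < N` of any
partial sum of the pieces by a constant times the corresponding `∑ a_k²`. The hypothesis on `Ψ`
only gives `∑ a_k^(1+s) ≤ η/s` for every `s ∈ (0, 1]`, but this rate at the endpoint extrapolates
to exponential integrability in `ν`, with a bound proportional to `η`, so the strong means tend
to `0`.

In the characteristic the weight of the `k`-th term is at most `(k+1)^(-3/2)`, so dominated
convergence applies. Almost every point is an `L^Ψ`-point because, off a null set, Lebesgue's
differentiation theorem holds for all the functions `Ψ(|f - r|)` with `r` rational.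
-/

namespace StrongApprox

section NFunctions

variable {x y t : ℝ}

theorem logPsi_of_nonneg (hx : 0 ≤ x) : logPsi x = (1 + x) * log (1 + x) - x := by
  rw [logPsi, abs_of_nonneg hx]

theorem expPhi_of_nonneg (hx : 0 ≤ x) : expPhi x = exp x - x - 1 := by
  rw [expPhi, abs_of_nonneg hx]

@[simp] theorem logPsi_zero : logPsi 0 = 0 := by simp [logPsi]

@[simp] theorem expPhi_zero : expPhi 0 = 0 := by simp [expPhi]

@[simp] theorem logPsi_abs (x : ℝ) : logPsi |x| = logPsi x := by simp [logPsi]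

theorem continuous_logPsi : Continuous logPsi := by
  unfold logPsi
  fun_prop (disch := intro; positivity)

theorem continuous_expPhi : Continuous expPhi := by
  unfold expPhi
  fun_prop

theorem convexOn_logPsi : ConvexOn ℝ (Set.Ici 0) logPsi := by
  have h : ConvexOn ℝ (Set.Ici 0) fun x : ℝ => (1 + x) * log (1 + x) :=
    (convexOn_mul_log.translate_right 1).subset
      (fun x (hx : 0 ≤ x) => show 0 ≤ 1 + x by linarith) (convex_Ici 0)
  exact (h.sub (concaveOn_id (convex_Ici 0))).congr fun x hx => (logPsi_of_nonneg hx).symm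

theorem convexOn_expPhi : ConvexOn ℝ (Set.Ici 0) expPhi := by
  have h := (convexOn_exp.subset (Set.subset_univ _) (convex_Ici 0)).sub
    ((concaveOn_id (convex_Ici 0)).add_const 1)
  exact h.congr fun x hx => by simp only [expPhi_of_nonneg hx, Pi.sub_apply, Pi.add_apply, id]; ring

theorem expPhi_nonneg (x : ℝ) : 0 ≤ expPhi x := by
  linarith [add_one_le_exp |x|, show expPhi x = exp |x| - |x| - 1 from rfl]

theorem expPhi_pos (hx : 0 < x) : 0 < expPhi x := by
  linarith [add_one_lt_exp hx.ne', expPhi_of_nonneg hx.le]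

theorem mul_le_expPhi_add_logPsi (ht : 0 ≤ t) (hx : 0 ≤ x) : t * x ≤ expPhi t + logPsi x := by
  have hx_pos : 0 < 1 + x := by linarith
  have hexp : (1 + x) * (t - log (1 + x) + 1) ≤ (1 + x) * exp (t - log (1 + x)) :=
    mul_le_mul_of_nonneg_left (add_one_le_exp _) hx_pos.le
  rw [exp_sub, exp_log hx_pos, mul_div_cancel₀ _ hx_pos.ne'] at hexp
  rw [logPsi_of_nonneg hx, expPhi_of_nonneg ht]
  linarith

theorem log_mul_eq_expPhi_add_logPsi (hx : 0 ≤ x) :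
    log (1 + x) * x = expPhi (log (1 + x)) + logPsi x := by
  rw [logPsi_of_nonneg hx, expPhi_of_nonneg (log_nonneg (by linarith)), exp_log (by linarith)]
  ring

theorem monotoneOn_logPsi : MonotoneOn logPsi (Set.Ici 0) := by
  intro x (hx : 0 ≤ x) y (hy : 0 ≤ y) hxy
  have hlog : 0 ≤ log (1 + x) := log_nonneg (by linarith)
  have := mul_le_mul_of_nonneg_left hxy hlog
  linarith [mul_le_expPhi_add_logPsi hlog hy, log_mul_eq_expPhi_add_logPsi hx]

theorem logPsi_nonneg (x : ℝ) : 0 ≤ logPsi x := by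
  simpa using monotoneOn_logPsi Set.self_mem_Ici (abs_nonneg x) (abs_nonneg x)

theorem monotoneOn_expPhi : MonotoneOn expPhi (Set.Ici 0) := by
  intro x (hx : 0 ≤ x) y (hy : 0 ≤ y) hxy
  have h : exp x * (y - x + 1) ≤ exp x * exp (y - x) :=
    mul_le_mul_of_nonneg_left (add_one_le_exp _) (exp_nonneg _)
  rw [← exp_add, add_sub_cancel] at h
  rw [expPhi_of_nonneg hx, expPhi_of_nonneg hy]
  nlinarith [one_le_exp hx]

theorem logPsi_le_sq (hx : 0 ≤ x) : logPsi x ≤ x ^ 2 := by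
  rw [logPsi_of_nonneg hx]
  nlinarith [log_le_sub_one_of_pos (show 0 < 1 + x by linarith)]

theorem expPhi_le_sq (hx : 0 ≤ x) (hx1 : x ≤ 1) : expPhi x ≤ x ^ 2 := by
  have h := abs_exp_sub_one_sub_id_le (x := x) (by rwa [abs_of_nonneg hx])
  linarith [expPhi_of_nonneg hx, le_abs_self (exp x - 1 - x)]

theorem mul_log_div_two_le_logPsi (hx : 0 ≤ x) : x * log (1 + x) / 2 ≤ logPsi x := by
  have h := le_log_one_add_of_nonneg hx
  rw [div_le_iff₀ (by linarith)] at h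
  linarith [logPsi_of_nonneg hx]

theorem logPsi_pos (hx : 0 < x) : 0 < logPsi x :=
  lt_of_lt_of_le (by have := log_pos (show 1 < 1 + x by linarith); positivity)
    (mul_log_div_two_le_logPsi hx.le)

theorem le_add_logPsi_div (ht : 0 < t) (ht1 : t ≤ 1) (hx : 0 ≤ x) : x ≤ t + logPsi x / t := by
  have h : x ≤ (t ^ 2 + logPsi x) / t := by
    rw [le_div_iff₀ ht]
    linarith [mul_le_expPhi_add_logPsi ht.le hx, expPhi_le_sq ht.le ht1]
  exact h.trans_eq (by field_simp)

theorem four_mul_expPhi_le (ht : 0 ≤ t) : 4 * expPhi t ≤ expPhi (2 * t) := by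
  have hexp := one_le_exp ht
  have hlog := le_log_one_add_of_nonneg (sub_nonneg.2 hexp)
  rw [add_sub_cancel, log_exp, div_le_iff₀ (by linarith)] at hlog
  rw [expPhi_of_nonneg ht, expPhi_of_nonneg (by positivity), two_mul, exp_add]
  have hcube : 0 ≤ (exp t - 1) ^ 3 := pow_nonneg (sub_nonneg.2 hexp) 3
  nlinarith

-- The `Δ₂`-condition for `Ψ` is dual to the growth of its conjugate `Φ`.
theorem logPsi_two_mul_le (hx : 0 ≤ x) : logPsi (2 * x) ≤ 4 * logPsi x := by
  have hlog : 0 ≤ log (1 + 2 * x) / 2 := by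
    have := log_nonneg (show 1 ≤ 1 + 2 * x by linarith)
    positivity
  have hdual := four_mul_expPhi_le hlog
  rw [mul_div_cancel₀ _ two_ne_zero] at hdual
  linarith [mul_le_expPhi_add_logPsi hlog hx,
    log_mul_eq_expPhi_add_logPsi (show 0 ≤ 2 * x by linarith)]

theorem map_add_le_of_convexOn {F : ℝ → ℝ} (hF : ConvexOn ℝ (Set.Ici 0) F) (hx : 0 ≤ x)
    (hy : 0 ≤ y) : F (x + y) ≤ (F (2 * x) + F (2 * y)) / 2 := by
  have h := hF.2 (show 2 * x ∈ Set.Ici 0 by simpa) (show 2 * y ∈ Set.Ici 0 by simpa)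
    (show (0 : ℝ) ≤ 1 / 2 by norm_num) (show (0 : ℝ) ≤ 1 / 2 by norm_num) (by norm_num)
  simp only [smul_eq_mul] at h
  ring_nf at h ⊢
  linarith

theorem expPhi_abs_add_le (x y : ℝ) :
    expPhi |x + y| ≤ (expPhi (2 * |x|) + expPhi (2 * |y|)) / 2 :=
  (monotoneOn_expPhi (abs_nonneg (x + y)) (Set.mem_Ici.2 (by positivity))
    (abs_add_le x y)).trans (map_add_le_of_convexOn convexOn_expPhi (abs_nonneg x) (abs_nonneg y))

theorem logPsi_abs_add_le (x y : ℝ) : logPsi |x + y| ≤ 2 * logPsi |x| + 2 * logPsi |y| := by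
  have h := monotoneOn_logPsi (abs_nonneg (x + y)) (Set.mem_Ici.2 (by positivity))
    (abs_add_le x y)
  linarith [map_add_le_of_convexOn convexOn_logPsi (abs_nonneg x) (abs_nonneg y),
    logPsi_two_mul_le (abs_nonneg x), logPsi_two_mul_le (abs_nonneg y)]

theorem deriv_logPsi (hx : 0 < x) : deriv logPsi x = log (1 + x) := by
  have hne : 1 + x ≠ 0 := by positivity
  have heq : logPsi =ᶠ[𝓝 x] fun y => (1 + y) * log (1 + y) - y := by
    filter_upwards [lt_mem_nhds hx] with y hy using logPsi_of_nonneg hy.le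
  have hadd : HasDerivAt (fun y : ℝ => 1 + y) 1 x := (hasDerivAt_id x).const_add 1
  have hderiv := ((hadd.mul (hadd.log hne)).sub (hasDerivAt_id x)).congr_of_eventuallyEq heq
  rw [hderiv.deriv]
  field_simp
  ring

end NFunctions

section Inverse

variable {Θ : ℝ → ℝ}

theorem surjOn_Ici_of_tendsto_atTop (hc : Continuous Θ) (h0 : Θ 0 = 0)
    (htop : Tendsto Θ atTop atTop) : Set.SurjOn Θ (Set.Ici 0) (Set.Ici 0) := by
  intro y (hy : 0 ≤ y)
  obtain ⟨u, hu0, hyu⟩ := ((eventually_ge_atTop 0).and (htop.eventually_ge_atTop y)).exists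
  obtain ⟨a, ha, rfl⟩ := intermediate_value_Icc hu0 hc.continuousOn ⟨h0.le.trans hy, hyu⟩
  exact ⟨a, ha.1, rfl⟩

theorem surjOn_logPsi : Set.SurjOn logPsi (Set.Ici 0) (Set.Ici 0) := by
  refine surjOn_Ici_of_tendsto_atTop continuous_logPsi logPsi_zero
    (tendsto_atTop_mono' _ ?_ (tendsto_atTop_add_const_right _ (-expPhi 1) tendsto_id))
  filter_upwards [eventually_ge_atTop 0] with x hx
  linarith [mul_le_expPhi_add_logPsi zero_le_one hx, id_eq x]

theorem surjOn_expPhi : Set.SurjOn expPhi (Set.Ici 0) (Set.Ici 0) := by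
  refine surjOn_Ici_of_tendsto_atTop continuous_expPhi expPhi_zero
    (tendsto_atTop_mono' _ ?_ (tendsto_atTop_add_const_right _ (-logPsi 1) tendsto_id))
  filter_upwards [eventually_ge_atTop 0] with x hx
  linarith [mul_le_expPhi_add_logPsi hx zero_le_one, id_eq x]

theorem nInv_nonneg {y : ℝ} (hsurj : Set.SurjOn Θ (Set.Ici 0) (Set.Ici 0)) (hy : 0 ≤ y) :
    0 ≤ nInv Θ y :=
  Function.invFunOn_mem (hsurj hy)

theorem map_nInv {y : ℝ} (hsurj : Set.SurjOn Θ (Set.Ici 0) (Set.Ici 0)) (hy : 0 ≤ y) :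
    Θ (nInv Θ y) = y :=
  Function.invFunOn_eq (hsurj hy)

theorem tendsto_nInv {ι : Type*} {l : Filter ι} {u : ι → ℝ} (hmono : MonotoneOn Θ (Set.Ici 0))
    (hpos : ∀ x, 0 < x → 0 < Θ x) (hsurj : Set.SurjOn Θ (Set.Ici 0) (Set.Ici 0))
    (hu : ∀ i, 0 ≤ u i) (hlim : Tendsto u l (𝓝 0)) :
    Tendsto (fun i => nInv Θ (u i)) l (𝓝 0) := by
  refine Metric.tendsto_nhds.2 fun ε hε => ?_
  filter_upwards [hlim.eventually_lt_const (hpos ε hε)] with i hi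
  rw [dist_zero_right, norm_of_nonneg (nInv_nonneg hsurj (hu i))]
  by_contra! hle
  have := hmono hε.le (nInv_nonneg hsurj (hu i)) hle
  rw [map_nInv hsurj (hu i)] at this
  exact this.not_gt hi

end Inverse

section WeightedSums

variable {s : ℝ}

theorem sum_mul_le_of_antitone {ψ v : ℕ → ℝ} {ε : ℝ}
    (hψ : ∀ K : ℕ, ∑ k ∈ Finset.range K, ψ k ≤ ε * K) (hv : Antitone v) (hv0 : ∀ k, 0 ≤ v k)
    (N : ℕ) : ∑ k ∈ Finset.range N, ψ k * v k ≤ ε * ∑ k ∈ Finset.range N, v k := by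
  suffices h : ∑ k ∈ Finset.range N, ψ k * v k + (ε * N - ∑ k ∈ Finset.range N, ψ k) * v N
      ≤ ε * ∑ k ∈ Finset.range N, v k by
    linarith [mul_nonneg (sub_nonneg.2 (hψ N)) (hv0 N)]
  induction N with
  | zero => simp
  | succ n ih =>
    have hstep := mul_le_mul_of_nonneg_left (hv n.le_succ) (sub_nonneg.2 (hψ (n + 1)))
    simp only [Finset.sum_range_succ, Nat.succ_eq_add_one] at hstep ⊢
    push_cast at hstep ⊢
    linarith

theorem mul_rpow_le_rpow_sub_rpow {x y : ℝ} (hx : 0 < x) (hxy : x ≤ y) (hs : 0 < s) :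
    s * (y - x) * y ^ (-(1 + s)) ≤ x ^ (-s) - y ^ (-s) := by
  have hy : 0 < y := hx.trans_le hxy
  have hbernoulli : 1 + s * (1 - x / y) ≤ (x / y) ^ (-s) := by
    have hlog := log_le_sub_one_of_pos (div_pos hx hy)
    rw [rpow_def_of_pos (div_pos hx hy)]
    nlinarith [add_one_le_exp (log (x / y) * (-s))]
  calc s * (y - x) * y ^ (-(1 + s)) = y ^ (-s) * (1 + s * (1 - x / y)) - y ^ (-s) := by
        rw [show -(1 + s) = -s - 1 by ring, rpow_sub_one hy.ne']
        field_simp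
        ring
    _ ≤ y ^ (-s) * (x / y) ^ (-s) - y ^ (-s) := by gcongr
    _ = x ^ (-s) - y ^ (-s) := by
        rw [← mul_rpow hy.le (by positivity), mul_div_cancel₀ _ hy.ne']

-- Discrete form of `∫ y ^ (-(1 + s)) dy ≤ 1 / s` over `[1, ∞)`.
theorem sum_mul_rpow_le {y d : ℕ → ℝ} (hy0 : y 0 = 1) (hd0 : d 0 = 1) (hy : Monotone y)
    (hd : ∀ k, d (k + 1) ≤ y (k + 1) - y k) (hs : 0 < s) (N : ℕ) :
    ∑ k ∈ Finset.range N, d k * y k ^ (-(1 + s)) ≤ 1 + 1 / s := by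
  have hypos : ∀ k, 0 < y k := fun k => by linarith [hy k.zero_le]
  cases N with
  | zero => rw [Finset.sum_range_zero]; positivity
  | succ n =>
    suffices h : s * ∑ k ∈ Finset.range (n + 1), d k * y k ^ (-(1 + s)) ≤ s + 1 - y n ^ (-s) by
      rw [show 1 + 1 / s = (s + 1) / s by field_simp, le_div_iff₀ hs]
      linarith [rpow_nonneg (hypos n).le (-s)]
    induction n with
    | zero => simp [hy0, hd0]
    | succ n ih =>
      have hstep : s * d (n + 1) * y (n + 1) ^ (-(1 + s)) ≤
          s * (y (n + 1) - y n) * y (n + 1) ^ (-(1 + s)) := by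
        have := (hypos (n + 1)).le
        gcongr
        exact hd n
      rw [Finset.sum_range_succ]
      linarith [mul_rpow_le_rpow_sub_rpow (hypos n) (hy n.le_succ) hs]

theorem sum_rpow_le (hs : 0 < s) (N : ℕ) :
    ∑ k ∈ Finset.range N, ((k : ℝ) + 1) ^ (-(1 + s)) ≤ 1 + 1 / s := by
  have h := sum_mul_rpow_le (y := fun k => (k : ℝ) + 1) (d := 1) (by simp) rfl
    (fun i j hij => by dsimp only; gcongr) (fun k => by simp) hs N
  simpa using h

/-- The decreasing weight `1 / (K (1 + log K) ^ (1 + s))` with `K = k + 1`. The summand `1` keeps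
the base of the power positive at `k = 0`. -/
noncomputable def logWeight (s : ℝ) (k : ℕ) : ℝ :=
  ((k : ℝ) + 1)⁻¹ * (1 + log ((k : ℝ) + 1)) ^ (-(1 + s))

theorem one_le_one_add_log (k : ℕ) : 1 ≤ 1 + log ((k : ℝ) + 1) :=
  le_add_of_nonneg_right (log_nonneg (by simp))

theorem logWeight_nonneg (s : ℝ) (k : ℕ) : 0 ≤ logWeight s k :=
  mul_nonneg (by positivity) (rpow_nonneg (by linarith [one_le_one_add_log k]) _)

theorem antitone_logWeight (hs : 0 < s) : Antitone (logWeight s) := by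
  intro i j hij
  have hi := one_le_one_add_log i
  have hj := one_le_one_add_log j
  have hbase : 1 + log ((i : ℝ) + 1) ≤ 1 + log ((j : ℝ) + 1) := by gcongr
  exact mul_le_mul (by gcongr) (rpow_le_rpow_of_nonpos (by linarith) hbase (by linarith))
    (rpow_nonneg (by linarith) _) (by positivity)

theorem inv_add_one_le_log_sub_log {x : ℝ} (hx : 0 < x) : (x + 1)⁻¹ ≤ log (x + 1) - log x := by
  have h := log_le_sub_one_of_pos (div_pos hx (show 0 < x + 1 by linarith))
  rw [log_div (by positivity) (by positivity)] at h
  have : x / (x + 1) - 1 = -(x + 1)⁻¹ := by field_simp; ring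
  linarith

theorem sum_logWeight_le (hs : 0 < s) (N : ℕ) :
    ∑ k ∈ Finset.range N, logWeight s k ≤ 1 + 1 / s := by
  refine sum_mul_rpow_le (y := fun k : ℕ => 1 + log ((k : ℝ) + 1)) (by simp) (by simp)
    (fun i j hij => by dsimp only; gcongr) (fun k => ?_) hs N
  push_cast
  linarith [inv_add_one_le_log_sub_log (show 0 < (k : ℝ) + 1 by positivity)]

end WeightedSums

section Extrapolation

variable {m s τ : ℝ}

theorem rpow_div_le_of_le_sqrt (hm : 0 ≤ m) (hτ : 0 < τ) (hτ1 : τ ≤ 1) (hs : 0 < s)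
    (k : ℕ) (h : m ≤ √((k : ℝ) + 1)) :
    (m / ((k : ℝ) + 1)) ^ (1 + s) ≤
      (τ + logPsi m / τ) * ((k : ℝ) + 1) ^ (-(1 + s / 2)) := by
  set K := (k : ℝ) + 1
  have hK : 0 < K := by positivity
  have hratio : m / K ≤ K ^ (-(1 / 2) : ℝ) := by
    rw [div_le_iff₀ hK, ← rpow_add_one hK.ne']
    exact h.trans_eq (by rw [sqrt_eq_rpow]; norm_num)
  have hpow : (m / K) ^ s ≤ K ^ (-(s / 2)) :=
    calc (m / K) ^ s ≤ (K ^ (-(1 / 2) : ℝ)) ^ s := by gcongr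
      _ = K ^ (-(s / 2)) := by rw [← rpow_mul hK.le]; ring_nf
  calc (m / K) ^ (1 + s) = m / K * (m / K) ^ s := rpow_one_add' (by positivity) (by linarith)
    _ ≤ m / K * K ^ (-(s / 2)) := by gcongr
    _ = m * K ^ (-(1 + s / 2)) := by
        rw [show -(1 + s / 2) = -(s / 2) - 1 by ring, rpow_sub_one hK.ne']; ring
    _ ≤ (τ + logPsi m / τ) * K ^ (-(1 + s / 2)) := by
        gcongr
        exact le_add_logPsi_div hτ hτ1 hm

theorem mul_one_add_log_le_logPsi {K : ℝ} (hK : 1 ≤ K) (h : √K ≤ m) :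
    m * (1 + log K) ≤ 8 * logPsi m := by
  have hm : 1 ≤ m := (one_le_sqrt.2 hK).trans h
  have hlogK : log K ≤ 2 * log (1 + m) := by
    rw [← log_rpow (by linarith)]
    refine log_le_log (by linarith) ?_
    rw [rpow_two]
    nlinarith [sq_sqrt (show 0 ≤ K by linarith), sqrt_nonneg K]
  have hlog2 : log 2 ≤ log (1 + m) := log_le_log two_pos (by linarith)
  have hlog : 1 + log K ≤ 4 * log (1 + m) := by linarith [log_two_gt_d9]
  calc m * (1 + log K) ≤ m * (4 * log (1 + m)) := by gcongr
    _ ≤ 8 * logPsi m := by linarith [mul_log_div_two_le_logPsi (show 0 ≤ m by linarith)]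

theorem rpow_div_le_of_sqrt_le (hs : 0 < s) (hs1 : s ≤ 1) (k : ℕ)
    (h : √((k : ℝ) + 1) ≤ m) (hψ : logPsi m ≤ (k : ℝ) + 1) :
    (m / ((k : ℝ) + 1)) ^ (1 + s) ≤ 64 * (logPsi m * logWeight s k) := by
  have hl := one_le_one_add_log k
  have hml := mul_one_add_log_le_logPsi (show 1 ≤ (k : ℝ) + 1 by simp) h
  have hm0 : 0 ≤ m := (sqrt_nonneg _).trans h
  have hψ0 := logPsi_nonneg m
  unfold logWeight
  set l := 1 + log ((k : ℝ) + 1)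
  set K := (k : ℝ) + 1
  have hK : 0 < K := by positivity
  have hl0 : 0 < l := by linarith
  have hratio : m / K ≤ 8 * logPsi m * K⁻¹ * l⁻¹ := by
    rw [← div_eq_mul_inv, ← div_eq_mul_inv, div_div, div_le_div_iff₀ hK (by positivity)]
    nlinarith
  have hpow : (m / K) ^ s ≤ 8 * l ^ (-s) :=
    calc (m / K) ^ s ≤ (8 * l⁻¹) ^ s := by
          refine rpow_le_rpow (by positivity) ?_ hs.le
          rw [← div_eq_mul_inv, div_le_div_iff₀ hK hl0]
          linarith
      _ = 8 ^ s * l ^ (-s) := by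
          rw [mul_rpow (by norm_num) (by positivity), inv_rpow hl0.le, rpow_neg hl0.le]
      _ ≤ 8 * l ^ (-s) := by
          gcongr
          exact rpow_le_self_of_one_le (by norm_num) hs1
  calc (m / K) ^ (1 + s) = m / K * (m / K) ^ s := rpow_one_add' (by positivity) (by linarith)
    _ ≤ (8 * logPsi m * K⁻¹ * l⁻¹) * (8 * l ^ (-s)) := by gcongr
    _ = 64 * (logPsi m * (K⁻¹ * l ^ (-(1 + s)))) := by
        rw [show -(1 + s) = -s - 1 by ring, rpow_sub_one hl0.ne']; ring

theorem rpow_div_le (hm : 0 ≤ m) (hτ : 0 < τ) (hτ1 : τ ≤ 1) (hs : 0 < s) (hs1 : s ≤ 1)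
    (k : ℕ) (hψ : logPsi m ≤ (k : ℝ) + 1) :
    (m / ((k : ℝ) + 1)) ^ (1 + s) ≤ τ * ((k : ℝ) + 1) ^ (-(1 + s / 2)) +
      1 / τ * (logPsi m * ((k : ℝ) + 1) ^ (-(1 + s / 2))) + 64 * (logPsi m * logWeight s k) := by
  have hψ0 := logPsi_nonneg m
  have hw := logWeight_nonneg s k
  rcases le_total m √((k : ℝ) + 1) with hsmall | hlarge
  · calc _ ≤ _ := rpow_div_le_of_le_sqrt hm hτ hτ1 hs k hsmall
      _ = τ * ((k : ℝ) + 1) ^ (-(1 + s / 2)) +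
          1 / τ * (logPsi m * ((k : ℝ) + 1) ^ (-(1 + s / 2))) := by ring
      _ ≤ _ := le_add_of_nonneg_right (by positivity)
  · exact (rpow_div_le_of_sqrt_le hs hs1 k hlarge hψ).trans
      (le_add_of_nonneg_left (by positivity))

-- As `s → 0` the exponent approaches the endpoint `1`, where the sum may grow logarithmically;
-- the blow-up rate `1 / s` is what the extrapolation to `Φ` needs.
theorem sum_rpow_div_le {m : ℕ → ℝ} (hm : ∀ k, 0 ≤ m k) (hτ : 0 < τ) (hτ1 : τ ≤ 1)
    (h : ∀ K : ℕ, ∑ k ∈ Finset.range K, logPsi (m k) ≤ τ ^ 2 * K)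
    (hs : 0 < s) (hs1 : s ≤ 1) (N : ℕ) :
    ∑ k ∈ Finset.range N, (m k / ((k : ℝ) + 1)) ^ (1 + s) ≤ 134 * τ / s := by
  have hψ : ∀ k, logPsi (m k) ≤ (k : ℝ) + 1 := fun k =>
    calc logPsi (m k) ≤ ∑ j ∈ Finset.range (k + 1), logPsi (m j) :=
          Finset.single_le_sum (f := fun j => logPsi (m j)) (fun j _ => logPsi_nonneg _)
            (Finset.self_mem_range_succ k)
      _ ≤ τ ^ 2 * ((k : ℝ) + 1) := by exact_mod_cast h (k + 1)
      _ ≤ (k : ℝ) + 1 := mul_le_of_le_one_left (by positivity) (pow_le_one₀ hτ.le hτ1)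
  let v : ℕ → ℝ := fun k => ((k : ℝ) + 1) ^ (-(1 + s / 2))
  have hv : Antitone v := fun i j hij =>
    rpow_le_rpow_of_nonpos (by positivity) (by gcongr) (by linarith)
  have hs_inv : 1 ≤ 1 / s := (one_le_div hs).2 hs1
  have hsum_v : ∑ k ∈ Finset.range N, v k ≤ 3 / s := by
    refine (sum_rpow_le (half_pos hs) N).trans ?_
    rw [one_div_div]
    linarith [show 3 / s = 2 / s + 1 / s by ring]
  have hsum_w : ∑ k ∈ Finset.range N, logWeight s k ≤ 2 / s := by
    linarith [sum_logWeight_le hs N, show 2 / s = 1 / s + 1 / s by ring]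
  calc ∑ k ∈ Finset.range N, (m k / ((k : ℝ) + 1)) ^ (1 + s)
      ≤ ∑ k ∈ Finset.range N,
        (τ * v k + 1 / τ * (logPsi (m k) * v k) + 64 * (logPsi (m k) * logWeight s k)) :=
        Finset.sum_le_sum fun k _ => rpow_div_le (hm k) hτ hτ1 hs hs1 k (hψ k)
    _ = τ * ∑ k ∈ Finset.range N, v k + 1 / τ * ∑ k ∈ Finset.range N, logPsi (m k) * v k
        + 64 * ∑ k ∈ Finset.range N, logPsi (m k) * logWeight s k := by
        simp only [Finset.sum_add_distrib, Finset.mul_sum]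
    _ ≤ τ * (3 / s) + 1 / τ * (τ ^ 2 * (3 / s)) + 64 * (τ ^ 2 * (2 / s)) := by
        gcongr
        · exact (sum_mul_le_of_antitone h hv (fun k => by positivity) N).trans (by gcongr)
        · exact (sum_mul_le_of_antitone h (antitone_logWeight hs) (logWeight_nonneg s) N).trans
            (by gcongr)
    _ = (6 * τ + 128 * τ ^ 2) / s := by field_simp; ring
    _ ≤ 134 * τ / s := by
        gcongr
        nlinarith

end Extrapolation

section ExponentialSummability

theorem le_exp_one_mul_rpow {a s : ℝ} (hs : 0 < s) (ha : exp (-(1 / s)) ≤ a) :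
    a ≤ exp 1 * a ^ (1 + s) := by
  have ha0 : 0 < a := (exp_pos _).trans_le ha
  have hpow : exp (-1) ≤ a ^ s :=
    calc exp (-1) = exp (-(1 / s)) ^ s := by rw [← exp_mul]; congr 1; field_simp
      _ ≤ a ^ s := by gcongr
  calc a = exp 1 * (a * exp (-1)) := by rw [mul_left_comm, ← exp_add]; simp
    _ ≤ exp 1 * (a * a ^ s) := by gcongr
    _ = exp 1 * a ^ (1 + s) := by rw [rpow_one_add' ha0.le (by linarith)]

theorem sq_le_exp_mul_rpow {a s : ℝ} (hs : 0 < s) (hs1 : s ≤ 1) (ha0 : 0 ≤ a)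
    (ha : a ≤ exp (-(1 / s))) : a ^ 2 ≤ exp (1 - 1 / s) * a ^ (1 + s) := by
  have hpow : a ^ (1 - s) ≤ exp (1 - 1 / s) :=
    calc a ^ (1 - s) ≤ exp (-(1 / s)) ^ (1 - s) := rpow_le_rpow ha0 ha (by linarith)
      _ = exp (1 - 1 / s) := by rw [← exp_mul]; congr 1; field_simp; ring
  calc a ^ 2 = a ^ (1 - s) * a ^ (1 + s) := by
        rw [← rpow_add_of_nonneg ha0 (by linarith) (by linarith), ← rpow_natCast]
        congr 1
        push_cast
        ring
    _ ≤ exp (1 - 1 / s) * a ^ (1 + s) := by gcongr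

theorem expPhi_le_sq_add_sum {x : ℝ} (hx : 0 ≤ x) {M : ℕ} (hM : x ≤ M) :
    expPhi x ≤ x ^ 2 +
      ∑ j ∈ Finset.range M, exp ((j : ℝ) + 2) * if (j : ℝ) + 1 < x then 1 else 0 := by
  have hterm : ∀ j ∈ Finset.range M,
      0 ≤ exp ((j : ℝ) + 2) * if (j : ℝ) + 1 < x then (1 : ℝ) else 0 := fun j _ => by positivity
  rcases le_or_gt x 1 with hx1 | hx1
  · exact (expPhi_le_sq hx hx1).trans (le_add_of_nonneg_right (Finset.sum_nonneg hterm))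
  obtain ⟨j, hj⟩ : ∃ j : ℕ, ⌈x⌉₊ = j + 2 :=
    Nat.exists_eq_add_of_le' (Nat.lt_ceil.2 (by exact_mod_cast hx1))
  have hupper : x ≤ (j : ℝ) + 2 := by exact_mod_cast hj ▸ Nat.le_ceil x
  have hlower : (j : ℝ) + 1 < x := by exact_mod_cast Nat.lt_ceil.1 (by omega : j + 1 < ⌈x⌉₊)
  have hjM : j ∈ Finset.range M :=
    Finset.mem_range.2 (by exact_mod_cast (by linarith : (j : ℝ) < M))
  calc expPhi x ≤ exp ((j : ℝ) + 2) := by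
        rw [expPhi_of_nonneg hx]
        linarith [exp_le_exp.2 hupper]
    _ = exp ((j : ℝ) + 2) * if (j : ℝ) + 1 < x then 1 else 0 := by rw [if_pos hlower, mul_one]
    _ ≤ _ := (Finset.single_le_sum hterm hjM).trans (le_add_of_nonneg_left (sq_nonneg x))

variable {ι κ : Type*} {I : Finset ι} {J : Finset κ} {a : ι → ℝ} {p : ι → κ → ℝ} {η s : ℝ}

theorem sum_filter_lt_le (ha : ∀ k ∈ I, 0 ≤ a k) (hs : 0 < s) :
    ∑ k ∈ I with exp (-(1 / s)) < a k, a k ≤ exp 1 * ∑ k ∈ I, a k ^ (1 + s) := by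
  rw [Finset.mul_sum]
  refine (Finset.sum_le_sum fun k hk => le_exp_one_mul_rpow hs (Finset.mem_filter.1 hk).2.le).trans
    (Finset.sum_le_sum_of_subset_of_nonneg (Finset.filter_subset _ _) fun k hk _ => ?_)
  have := ha k hk
  positivity

theorem sum_filter_not_lt_sq_le (ha : ∀ k ∈ I, 0 ≤ a k) (hs : 0 < s) (hs1 : s ≤ 1) :
    ∑ k ∈ I with ¬ exp (-(1 / s)) < a k, a k ^ 2 ≤
      exp (1 - 1 / s) * ∑ k ∈ I, a k ^ (1 + s) := by
  rw [Finset.mul_sum]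
  refine (Finset.sum_le_sum fun k hk => ?_).trans
    (Finset.sum_le_sum_of_subset_of_nonneg (Finset.filter_subset _ _) fun k hk _ => ?_)
  · obtain ⟨hkI, hk⟩ := Finset.mem_filter.1 hk
    exact sq_le_exp_mul_rpow hs hs1 (ha k hkI) (not_lt.1 hk)
  · have := ha k hk
    positivity

/- Split the sum over `k` at `a k = e^{-1/s}`: the large terms contribute at most half of the level,
and the small ones are handled by Chebyshev's inequality in `L²`. -/
theorem card_filter_lt_abs_sum_le (ha : ∀ k ∈ I, 0 ≤ a k) (hη : 0 < η) (hs : 0 < s) (hs1 : s ≤ 1)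
    (hpow : ∑ k ∈ I, a k ^ (1 + s) ≤ η / s) (hp : ∀ k ∈ I, ∀ ν ∈ J, |p k ν| ≤ a k)
    (hsq : ∀ E ⊆ I, ∑ ν ∈ J, (∑ k ∈ E, p k ν) ^ 2 ≤ J.card * ∑ k ∈ E, a k ^ 2) :
    ({ν ∈ J | 6 * (η / s) < |∑ k ∈ I, p k ν|}.card : ℝ) ≤
      J.card * (exp (1 - 1 / s) * (s / (9 * η))) := by
  have hlarge : ∀ ν ∈ J, |∑ k ∈ I with exp (-(1 / s)) < a k, p k ν| ≤ 3 * (η / s) := fun ν hν =>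
    calc _ ≤ ∑ k ∈ I with exp (-(1 / s)) < a k, a k :=
          (Finset.abs_sum_le_sum_abs _ _).trans
            (Finset.sum_le_sum fun k hk => hp k (Finset.mem_filter.1 hk).1 ν hν)
      _ ≤ exp 1 * (η / s) := (sum_filter_lt_le ha hs).trans (by gcongr)
      _ ≤ 3 * (η / s) := by gcongr; exact exp_one_lt_three.le
  have hlevel : ∀ ν ∈ J, 6 * (η / s) < |∑ k ∈ I, p k ν| →
      (3 * (η / s)) ^ 2 ≤ (∑ k ∈ I with ¬ exp (-(1 / s)) < a k, p k ν) ^ 2 := by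
    intro ν hν h
    rw [← Finset.sum_filter_add_sum_filter_not I (fun k => exp (-(1 / s)) < a k)] at h
    rw [← sq_abs (∑ k ∈ I with ¬ exp (-(1 / s)) < a k, p k ν)]
    gcongr
    linarith [abs_add_le (∑ k ∈ I with exp (-(1 / s)) < a k, p k ν)
      (∑ k ∈ I with ¬ exp (-(1 / s)) < a k, p k ν), hlarge ν hν]
  have hcheb : ({ν ∈ J | 6 * (η / s) < |∑ k ∈ I, p k ν|}.card : ℝ) * (3 * (η / s)) ^ 2 ≤
      J.card * (exp (1 - 1 / s) * (η / s)) :=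
    calc _ = ∑ ν ∈ J with 6 * (η / s) < |∑ k ∈ I, p k ν|, (3 * (η / s)) ^ 2 := by
          rw [Finset.sum_const, nsmul_eq_mul]
      _ ≤ ∑ ν ∈ J with 6 * (η / s) < |∑ k ∈ I, p k ν|,
            (∑ k ∈ I with ¬ exp (-(1 / s)) < a k, p k ν) ^ 2 :=
          Finset.sum_le_sum fun ν hν =>
            hlevel ν (Finset.mem_filter.1 hν).1 (Finset.mem_filter.1 hν).2
      _ ≤ ∑ ν ∈ J, (∑ k ∈ I with ¬ exp (-(1 / s)) < a k, p k ν) ^ 2 :=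
          Finset.sum_le_sum_of_subset_of_nonneg (Finset.filter_subset _ _) fun _ _ _ => sq_nonneg _
      _ ≤ J.card * ∑ k ∈ I with ¬ exp (-(1 / s)) < a k, a k ^ 2 :=
          hsq _ (Finset.filter_subset _ _)
      _ ≤ J.card * (exp (1 - 1 / s) * (η / s)) := by
          gcongr
          exact (sum_filter_not_lt_sq_le ha hs hs1).trans (by gcongr)
  rw [← le_div_iff₀ (by positivity)] at hcheb
  exact hcheb.trans_eq (by field_simp; ring)

theorem exp_one_sub_inv_le {x : ℝ} (hx : 0 < x) : exp (1 - 1 / x) ≤ 3 * x := by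
  have hinv : exp (-(1 / x)) ≤ x := by
    rw [exp_neg, inv_le_comm₀ (exp_pos _) hx, ← one_div]
    linarith [add_one_le_exp (1 / x)]
  rw [sub_eq_add_neg, exp_add]
  gcongr
  exact exp_one_lt_three.le

theorem exp_mul_card_filter_lt_abs_sum_le (ha : ∀ k ∈ I, 0 ≤ a k) (hη : 0 < η) (hη1 : η ≤ 1 / 36)
    (hpow : ∀ s, 0 < s → s ≤ 1 → ∑ k ∈ I, a k ^ (1 + s) ≤ η / s)
    (hp : ∀ k ∈ I, ∀ ν ∈ J, |p k ν| ≤ a k)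
    (hsq : ∀ E ⊆ I, ∑ ν ∈ J, (∑ k ∈ E, p k ν) ^ 2 ≤ J.card * ∑ k ∈ E, a k ^ 2) (j : ℕ) :
    exp ((j : ℝ) + 2) * ({ν ∈ J | (j : ℝ) + 1 < |∑ k ∈ I, p k ν|}.card : ℝ) ≤
      J.card * (108 * η * (1 / 2) ^ j) := by
  have hs0 : 0 < 6 * η / ((j : ℝ) + 1) := by positivity
  have hs1 : 6 * η / ((j : ℝ) + 1) ≤ 1 := by
    rw [div_le_one (by positivity)]
    linarith [Nat.cast_nonneg (α := ℝ) j]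
  have hcard := card_filter_lt_abs_sum_le ha hη hs0 hs1 (hpow _ hs0 hs1) hp hsq
  rw [show 6 * (η / (6 * η / ((j : ℝ) + 1))) = (j : ℝ) + 1 by field_simp] at hcard
  have hratio : exp (1 - 1 / (6 * η)) ≤ 1 / 2 :=
    (exp_one_sub_inv_le (by positivity)).trans (by linarith)
  have hexp2 : exp 2 ≤ 9 := by
    rw [show (2 : ℝ) = 1 + 1 by norm_num, exp_add]
    nlinarith [exp_one_lt_three, exp_pos 1]
  calc _ ≤ exp ((j : ℝ) + 2) * (J.card * (exp (1 - 1 / (6 * η / ((j : ℝ) + 1))) *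
        (6 * η / ((j : ℝ) + 1) / (9 * η)))) := by gcongr
    _ = J.card * (exp 2 * exp (1 - 1 / (6 * η)) ^ (j + 1) * (2 / 3 * ((j : ℝ) + 1)⁻¹)) := by
        have hexp : exp ((j : ℝ) + 2) * exp (1 - 1 / (6 * η / ((j : ℝ) + 1))) =
            exp 2 * exp (1 - 1 / (6 * η)) ^ (j + 1) := by
          rw [← exp_nat_mul, ← exp_add, ← exp_add]
          congr 1
          push_cast
          field_simp
          ring
        rw [← hexp]
        field_simp
        ring
    _ ≤ J.card * (9 * ((1 / 2) ^ j * (3 * (6 * η))) * (2 / 3 * 1)) := by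
        rw [pow_succ]
        gcongr
        · exact exp_one_sub_inv_le (by positivity)
        · exact inv_le_one_of_one_le₀ (by simp)
    _ = J.card * (108 * η * (1 / 2) ^ j) := by ring

theorem sum_expPhi_abs_sum_le (ha : ∀ k ∈ I, 0 ≤ a k) (hη : 0 < η) (hη1 : η ≤ 1 / 36)
    (hpow : ∀ s, 0 < s → s ≤ 1 → ∑ k ∈ I, a k ^ (1 + s) ≤ η / s)
    (hp : ∀ k ∈ I, ∀ ν ∈ J, |p k ν| ≤ a k)
    (hsq : ∀ E ⊆ I, ∑ ν ∈ J, (∑ k ∈ E, p k ν) ^ 2 ≤ J.card * ∑ k ∈ E, a k ^ 2) :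
    ∑ ν ∈ J, expPhi |∑ k ∈ I, p k ν| ≤ J.card * (217 * η) := by
  obtain ⟨M, hM⟩ : ∃ M : ℕ, ∀ ν ∈ J, |∑ k ∈ I, p k ν| ≤ M :=
    (exists_nat_ge (∑ ν ∈ J, |∑ k ∈ I, p k ν|)).imp fun M hM ν hν =>
      (Finset.single_le_sum (fun _ _ => abs_nonneg _) hν).trans hM
  have hsq_sum : ∑ ν ∈ J, |∑ k ∈ I, p k ν| ^ 2 ≤ J.card * η := by
    have h := hpow 1 one_pos le_rfl
    rw [one_add_one_eq_two, div_one] at h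
    simp only [rpow_two] at h
    simp only [sq_abs]
    exact (hsq I subset_rfl).trans (by gcongr)
  calc ∑ ν ∈ J, expPhi |∑ k ∈ I, p k ν|
      ≤ ∑ ν ∈ J, (|∑ k ∈ I, p k ν| ^ 2 + ∑ j ∈ Finset.range M,
          exp ((j : ℝ) + 2) * if (j : ℝ) + 1 < |∑ k ∈ I, p k ν| then 1 else 0) :=
        Finset.sum_le_sum fun ν hν => expPhi_le_sq_add_sum (abs_nonneg _) (hM ν hν)
    _ = ∑ ν ∈ J, |∑ k ∈ I, p k ν| ^ 2 + ∑ j ∈ Finset.range M,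
          exp ((j : ℝ) + 2) * ({ν ∈ J | (j : ℝ) + 1 < |∑ k ∈ I, p k ν|}.card : ℝ) := by
        rw [Finset.sum_add_distrib, Finset.sum_comm]
        simp only [← Finset.mul_sum, Finset.sum_boole]
    _ ≤ J.card * η + ∑ j ∈ Finset.range M, J.card * (108 * η * (1 / 2) ^ j) :=
        add_le_add hsq_sum (Finset.sum_le_sum fun j _ =>
          exp_mul_card_filter_lt_abs_sum_le ha hη hη1 hpow hp hsq j)
    _ = J.card * (η + 108 * η * ∑ j ∈ Finset.range M, (1 / 2 : ℝ) ^ j) := by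
        simp only [Finset.mul_sum, mul_add]
    _ ≤ J.card * (217 * η) := by
        gcongr
        nlinarith [sum_geometric_two_le M]

end ExponentialSummability

section Dirichlet

/-- The Dirichlet kernel `1/2 + ∑_{k=1}^ν cos kt`; with this normalization its integral over
`[0, π]` is `π / 2`. -/
noncomputable def dirichletKernel (ν : ℕ) (t : ℝ) : ℝ :=
  1 / 2 + ∑ k ∈ Finset.Icc 1 ν, cos (k * t)

@[fun_prop]
theorem continuous_dirichletKernel (ν : ℕ) : Continuous (dirichletKernel ν) := by
  unfold dirichletKernel
  fun_prop

theorem dirichletKernel_zero (t : ℝ) : dirichletKernel 0 t = 1 / 2 := by simp [dirichletKernel]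

theorem dirichletKernel_succ (ν : ℕ) (t : ℝ) :
    dirichletKernel (ν + 1) t = dirichletKernel ν t + cos (((ν : ℝ) + 1) * t) := by
  rw [dirichletKernel, dirichletKernel, Finset.sum_Icc_succ_top (by omega)]
  push_cast
  ring

theorem dirichletKernel_neg (ν : ℕ) (t : ℝ) : dirichletKernel ν (-t) = dirichletKernel ν t := by
  simp only [dirichletKernel, mul_neg, cos_neg]

theorem two_sin_mul_dirichletKernel (ν : ℕ) (t : ℝ) :
    2 * sin (t / 2) * dirichletKernel ν t = sin (((ν : ℝ) + 1 / 2) * t) := by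
  induction ν with
  | zero => rw [dirichletKernel_zero, Nat.cast_zero]; ring_nf
  | succ n ih =>
    have hupper : (((n + 1 : ℕ) : ℝ) + 1 / 2) * t = ((n : ℝ) + 1) * t + t / 2 := by
      push_cast; ring
    have hlower : ((n : ℝ) + 1 / 2) * t = ((n : ℝ) + 1) * t - t / 2 := by ring
    rw [dirichletKernel_succ, mul_add, ih, hupper, hlower, sin_add, sin_sub]
    ring

theorem abs_dirichletKernel_le (ν : ℕ) (t : ℝ) : |dirichletKernel ν t| ≤ ν + 1 / 2 := by
  induction ν with
  | zero => rw [dirichletKernel_zero]; norm_num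
  | succ n ih =>
    rw [dirichletKernel_succ]
    push_cast
    linarith [abs_add_le (dirichletKernel n t) (cos (((n : ℝ) + 1) * t)),
      abs_cos_le_one (((n : ℝ) + 1) * t)]

theorem integral_cos_int_mul {j : ℤ} (hj : j ≠ 0) : ∫ t in (0 : ℝ)..π, cos (j * t) = 0 := by
  rw [intervalIntegral.integral_comp_mul_left cos (Int.cast_ne_zero.2 hj), integral_cos,
    sin_int_mul_pi, mul_zero, sin_zero, sub_zero, smul_zero]

theorem integral_dirichletKernel (ν : ℕ) : ∫ t in (0 : ℝ)..π, dirichletKernel ν t = π / 2 := by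
  induction ν with
  | zero =>
    simp only [dirichletKernel_zero, intervalIntegral.integral_const, smul_eq_mul]
    ring
  | succ n ih =>
    have hcos := integral_cos_int_mul (j := (n : ℤ) + 1) (by omega)
    push_cast at hcos
    simp only [dirichletKernel_succ]
    rw [intervalIntegral.integral_add (Continuous.intervalIntegrable (by fun_prop) _ _)
      (Continuous.intervalIntegrable (by fun_prop) _ _), ih, hcos, add_zero]

end Dirichlet

section Orthogonality

theorem integral_cos_sub_add_cos_add (σ : ℝ) (ν μ : ℕ) :
    ∫ t in (0 : ℝ)..π, (1 / 2 * cos (((ν : ℤ) - μ : ℤ) * t) +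
      σ / 2 * cos (((ν : ℤ) + μ + 1 : ℤ) * t)) = if ν = μ then π / 2 else 0 := by
  rw [intervalIntegral.integral_add (Continuous.intervalIntegrable (by fun_prop) _ _)
    (Continuous.intervalIntegrable (by fun_prop) _ _), intervalIntegral.integral_const_mul,
    intervalIntegral.integral_const_mul, integral_cos_int_mul (j := (ν : ℤ) + μ + 1) (by omega),
    mul_zero, add_zero]
  split_ifs with h
  · subst h
    simp only [sub_self, Int.cast_zero, zero_mul, cos_zero, intervalIntegral.integral_const,
      smul_eq_mul]
    ring
  · rw [integral_cos_int_mul (by omega), mul_zero]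

theorem integral_sin_mul_sin (ν μ : ℕ) :
    ∫ t in (0 : ℝ)..π, sin (((ν : ℝ) + 1 / 2) * t) * sin (((μ : ℝ) + 1 / 2) * t) =
      if ν = μ then π / 2 else 0 := by
  rw [← integral_cos_sub_add_cos_add (-1)]
  refine intervalIntegral.integral_congr fun t _ => ?_
  have hsub := cos_sub (((ν : ℝ) + 1 / 2) * t) (((μ : ℝ) + 1 / 2) * t)
  have hadd := cos_add (((ν : ℝ) + 1 / 2) * t) (((μ : ℝ) + 1 / 2) * t)
  push_cast
  ring_nf at hsub hadd ⊢
  linarith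

theorem integral_cos_mul_cos (ν μ : ℕ) :
    ∫ t in (0 : ℝ)..π, cos (((ν : ℝ) + 1 / 2) * t) * cos (((μ : ℝ) + 1 / 2) * t) =
      if ν = μ then π / 2 else 0 := by
  rw [← integral_cos_sub_add_cos_add 1]
  refine intervalIntegral.integral_congr fun t _ => ?_
  have hsub := cos_sub (((ν : ℝ) + 1 / 2) * t) (((μ : ℝ) + 1 / 2) * t)
  have hadd := cos_add (((ν : ℝ) + 1 / 2) * t) (((μ : ℝ) + 1 / 2) * t)
  push_cast
  ring_nf at hsub hadd ⊢
  linarith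

theorem integral_sq_sum_of_orthogonal {ι : Type*} [DecidableEq ι] {e : ι → ℝ → ℝ} {a b A : ℝ}
    (he : ∀ ν, Continuous (e ν))
    (ho : ∀ ν μ, ∫ t in a..b, e ν t * e μ t = if ν = μ then A else 0) (J : Finset ι) (c : ι → ℝ) :
    ∫ t in a..b, (∑ ν ∈ J, c ν * e ν t) ^ 2 = A * ∑ ν ∈ J, c ν ^ 2 := by
  have hexpand : ∀ t : ℝ, (∑ ν ∈ J, c ν * e ν t) ^ 2 =
      ∑ ν ∈ J, ∑ μ ∈ J, (c ν * c μ) * (e ν t * e μ t) := fun t => by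
    rw [sq, Finset.sum_mul_sum]
    exact Finset.sum_congr rfl fun ν _ => Finset.sum_congr rfl fun μ _ => by ring
  simp only [hexpand]
  rw [intervalIntegral.integral_finsetSum
    fun ν _ => Continuous.intervalIntegrable (by fun_prop) _ _, Finset.mul_sum]
  refine Finset.sum_congr rfl fun ν hν => ?_
  rw [intervalIntegral.integral_finsetSum
    fun μ _ => Continuous.intervalIntegrable (by fun_prop) _ _]
  simp only [intervalIntegral.integral_const_mul, ho]
  rw [Finset.sum_eq_single_of_mem ν hν fun μ _ hμ => by rw [if_neg hμ.symm, mul_zero], if_pos rfl]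
  ring

end Orthogonality

section Sampling

variable {T T' : ℝ → ℝ} {n : ℝ}

theorem abs_sq_sub_sq_le_integral (hT : ∀ t, HasDerivAt T (T' t) t) (hT' : Continuous T')
    (hn : 0 < n) {u v : ℝ} (huv : u ≤ v) :
    |T v ^ 2 - T u ^ 2| ≤ ∫ x in u..v, (n * T x ^ 2 + 1 / n * T' x ^ 2) := by
  have hTc : Continuous T := continuous_iff_continuousAt.2 fun t => (hT t).continuousAt
  have hsq : ∀ x, HasDerivAt (fun x => T x ^ 2) (2 * T x * T' x) x := fun x => by
    simpa using (hT x).fun_pow 2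
  have hamgm : ∀ x, |2 * T x * T' x| ≤ n * T x ^ 2 + 1 / n * T' x ^ 2 := fun x => by
    have hpos : 0 ≤ (n * |T x| - |T' x|) ^ 2 / n := by positivity
    rw [abs_mul, abs_mul, abs_two, ← sq_abs (T x), ← sq_abs (T' x)]
    have : (n * |T x| - |T' x|) ^ 2 / n =
        n * |T x| ^ 2 + 1 / n * |T' x| ^ 2 - 2 * |T x| * |T' x| := by
      field_simp
      ring
    linarith
  rw [← intervalIntegral.integral_eq_sub_of_hasDerivAt (fun x _ => hsq x)
    (Continuous.intervalIntegrable (by fun_prop) _ _)]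
  exact (intervalIntegral.abs_integral_le_integral_abs huv).trans
    (intervalIntegral.integral_mono_on huv (Continuous.intervalIntegrable (by fun_prop) _ _)
      (Continuous.intervalIntegrable (by fun_prop) _ _) fun x _ => hamgm x)

theorem sq_le_integral_add_integral (hT : ∀ t, HasDerivAt T (T' t) t) (hT' : Continuous T')
    (hn : 0 < n) {a b t : ℝ} (hab : a < b) (ht : t ∈ Set.Icc a b) :
    T t ^ 2 ≤ 1 / (b - a) * (∫ u in a..b, T u ^ 2) +
      ∫ u in a..b, (n * T u ^ 2 + 1 / n * T' u ^ 2) := by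
  have hTc : Continuous T := continuous_iff_continuousAt.2 fun t => (hT t).continuousAt
  set Q := ∫ u in a..b, (n * T u ^ 2 + 1 / n * T' u ^ 2)
  have hmono : ∀ u v, a ≤ u → u ≤ v → v ≤ b → |T v ^ 2 - T u ^ 2| ≤ Q := fun u v hau huv hvb =>
    (abs_sq_sub_sq_le_integral hT hT' hn huv).trans
      (intervalIntegral.integral_mono_interval hau huv hvb
        (ae_of_all _ fun x => by dsimp only [Pi.zero_apply]; positivity)
        (Continuous.intervalIntegrable (by fun_prop) _ _))
  have hosc : ∀ u ∈ Set.Icc a b, T t ^ 2 - Q ≤ T u ^ 2 := fun u hu => by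
    rcases le_total u t with h | h
    · linarith [le_abs_self (T t ^ 2 - T u ^ 2), hmono u t hu.1 h ht.2]
    · linarith [neg_abs_le (T u ^ 2 - T t ^ 2), hmono t u ht.1 h hu.2]
  have hint := intervalIntegral.integral_mono_on hab.le
    (continuous_const.intervalIntegrable (μ := volume) a b)
    (Continuous.intervalIntegrable (u := fun u => T u ^ 2) (by fun_prop) _ _) hosc
  rw [intervalIntegral.integral_const, smul_eq_mul] at hint
  rw [one_div, ← div_eq_inv_mul, ← sub_le_iff_le_add, le_div_iff₀ (sub_pos.2 hab)]
  linarith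

theorem sum_sq_le_integral_add_integral (hT : ∀ t, HasDerivAt T (T' t) t) (hT' : Continuous T')
    (hn : 0 < n) {x t : ℕ → ℝ} {h : ℝ} (hh : 0 < h) (hx : ∀ k, x (k + 1) - x k = h)
    (ht : ∀ k, t k ∈ Set.Icc (x k) (x (k + 1))) (N : ℕ) :
    ∑ k ∈ Finset.range N, T (t k) ^ 2 ≤ 1 / h * (∫ u in x 0..x N, T u ^ 2) +
      ∫ u in x 0..x N, (n * T u ^ 2 + 1 / n * T' u ^ 2) := by
  have hTc : Continuous T := continuous_iff_continuousAt.2 fun t => (hT t).continuousAt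
  rw [← intervalIntegral.sum_integral_adjacent_intervals
      fun k _ => Continuous.intervalIntegrable (by fun_prop) _ _,
    ← intervalIntegral.sum_integral_adjacent_intervals
      fun k _ => Continuous.intervalIntegrable (by fun_prop) _ _,
    Finset.mul_sum, ← Finset.sum_add_distrib]
  refine Finset.sum_le_sum fun k _ => ?_
  rw [← hx k]
  exact sq_le_integral_add_integral hT hT' hn (sub_pos.1 (hh.trans_eq (hx k).symm)) (ht k)

end Sampling

section LargeSieve

/-- The `k`-th node `kπ / N` of the partition of `[0, π]` into `N` intervals of equal length. -/
noncomputable def node (N k : ℕ) : ℝ := k * (π / N)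

variable {N k ν : ℕ} {t : ℝ}

theorem node_zero (N : ℕ) : node N 0 = 0 := by simp [node]

theorem node_nonneg (N k : ℕ) : 0 ≤ node N k := by unfold node; positivity

theorem node_self (hN : 0 < N) : node N N = π := by
  unfold node
  field_simp

theorem node_succ_sub (N k : ℕ) : node N (k + 1) - node N k = π / N := by
  unfold node
  push_cast
  ring

theorem node_lt_succ (hN : 0 < N) (k : ℕ) : node N k < node N (k + 1) :=
  sub_pos.1 (node_succ_sub N k ▸ by positivity)

theorem node_le_pi (hk : k ≤ N) : node N k ≤ π := by
  rcases Nat.eq_zero_or_pos N with rfl | hN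
  · simpa [node] using pi_pos.le
  · calc node N k ≤ N * (π / N) := by unfold node; gcongr
      _ = π := node_self hN

theorem integral_sq_sum_cos_le (N : ℕ) (c : ℕ → ℝ) :
    ∫ t in (0 : ℝ)..π,
      (∑ ν ∈ Finset.range N, (c ν * ((ν : ℝ) + 1 / 2)) * cos (((ν : ℝ) + 1 / 2) * t)) ^ 2 ≤
      π / 2 * (N ^ 2 * ∑ ν ∈ Finset.range N, c ν ^ 2) := by
  rw [integral_sq_sum_of_orthogonal (e := fun ν : ℕ => fun t => cos (((ν : ℝ) + 1 / 2) * t))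
    (fun ν => by fun_prop) integral_cos_mul_cos, Finset.mul_sum (a := (N : ℝ) ^ 2)]
  gcongr with ν hν
  have hνN : (ν : ℝ) + 1 ≤ N := by exact_mod_cast Finset.mem_range.1 hν
  rw [mul_pow, mul_comm]
  gcongr
  linarith

theorem sum_sq_sin_le (hN : 0 < N) (c : ℕ → ℝ) {x : ℕ → ℝ}
    (hx : ∀ k, x k ∈ Set.Icc (node N k) (node N (k + 1))) :
    ∑ k ∈ Finset.range N, (∑ ν ∈ Finset.range N, c ν * sin (((ν : ℝ) + 1 / 2) * x k)) ^ 2 ≤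
      4 * N * ∑ ν ∈ Finset.range N, c ν ^ 2 := by
  have hN' : (0 : ℝ) < N := Nat.cast_pos.2 hN
  set S := ∑ ν ∈ Finset.range N, c ν ^ 2
  set T : ℝ → ℝ := fun t => ∑ ν ∈ Finset.range N, c ν * sin (((ν : ℝ) + 1 / 2) * t)
  set T' : ℝ → ℝ := fun t =>
    ∑ ν ∈ Finset.range N, (c ν * ((ν : ℝ) + 1 / 2)) * cos (((ν : ℝ) + 1 / 2) * t)
  have hderiv : ∀ t, HasDerivAt T (T' t) t := fun t =>
    HasDerivAt.fun_sum fun ν _ =>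
      ((((hasDerivAt_id t).const_mul ((ν : ℝ) + 1 / 2)).sin).const_mul (c ν)).congr_deriv
        (by simp only [id]; ring)
  have hsieve := sum_sq_le_integral_add_integral hderiv (by fun_prop) hN' (by positivity)
    (node_succ_sub N) hx N
  have hT2 : ∫ t in (0 : ℝ)..π, T t ^ 2 = π / 2 * S :=
    integral_sq_sum_of_orthogonal (e := fun ν : ℕ => fun t => sin (((ν : ℝ) + 1 / 2) * t))
      (fun ν => by fun_prop) integral_sin_mul_sin _ c
  rw [node_zero, node_self hN,
    intervalIntegral.integral_add (Continuous.intervalIntegrable (by fun_prop) _ _)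
      (Continuous.intervalIntegrable (by fun_prop) _ _), intervalIntegral.integral_const_mul,
    intervalIntegral.integral_const_mul, hT2] at hsieve
  have hS : 0 ≤ N * S := mul_nonneg hN'.le (Finset.sum_nonneg fun ν _ => sq_nonneg (c ν))
  calc _ ≤ _ := hsieve
    _ ≤ 1 / (π / N) * (π / 2 * S) + (N * (π / 2 * S) + 1 / N * (π / 2 * (N ^ 2 * S))) := by
        gcongr
        exact integral_sq_sum_cos_le N c
    _ = (1 / 2 + π) * (N * S) := by field_simp; ring
    _ ≤ 4 * (N * S) := mul_le_mul_of_nonneg_right (by linarith [pi_lt_d2]) hS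
    _ = 4 * N * S := by ring

theorem add_one_div_le_two_mul_sin (hk : k < N) (hk0 : k ≠ 0)
    (ht : t ∈ Set.Icc (node N k) (node N (k + 1))) : ((k : ℝ) + 1) / N ≤ 2 * sin (t / 2) := by
  have hN : (0 : ℝ) < N := Nat.cast_pos.2 (by omega)
  have hk1 : (1 : ℝ) ≤ k := Nat.one_le_cast.2 (Nat.one_le_iff_ne_zero.2 hk0)
  calc ((k : ℝ) + 1) / N ≤ 2 * k / N := by gcongr; linarith
    _ = 2 * (2 / π * (node N k / 2)) := by unfold node; field_simp
    _ ≤ 2 * (2 / π * (t / 2)) := by gcongr; exact ht.1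
    _ ≤ 2 * sin (t / 2) := by
        gcongr
        exact mul_le_sin (by linarith [node_nonneg N k, ht.1]) (by linarith [ht.2, node_le_pi hk])

theorem abs_dirichletKernel_le_div (hk : k < N) (hν : ν < N)
    (ht : t ∈ Set.Icc (node N k) (node N (k + 1))) :
    |dirichletKernel ν t| ≤ N / ((k : ℝ) + 1) := by
  have hN : (0 : ℝ) < N := Nat.cast_pos.2 (by omega)
  rcases eq_or_ne k 0 with rfl | hk0
  · have hνN : (ν : ℝ) + 1 ≤ N := by exact_mod_cast hν
    rw [Nat.cast_zero, zero_add, div_one]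
    linarith [abs_dirichletKernel_le ν t]
  · have hsin := add_one_div_le_two_mul_sin hk hk0 ht
    have hpos : 0 < ((k : ℝ) + 1) / N := by positivity
    rw [← inv_div, ← one_div, le_div_iff₀ hpos]
    calc |dirichletKernel ν t| * (((k : ℝ) + 1) / N)
        ≤ |dirichletKernel ν t| * (2 * sin (t / 2)) := by gcongr
      _ = |2 * sin (t / 2) * dirichletKernel ν t| := by
          rw [abs_mul, abs_of_pos (hpos.trans_le hsin), mul_comm]
      _ ≤ 1 := two_sin_mul_dirichletKernel ν t ▸ abs_sin_le_one _

theorem sq_sum_mul_div_card_le {ι : Type*} {J : Finset ι} {d : ι → ℝ} (c : ι → ℝ)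
    (hd : ∀ ν ∈ J, |d ν| ≤ J.card) :
    ((∑ ν ∈ J, c ν * d ν) / J.card) ^ 2 ≤ J.card * ∑ ν ∈ J, c ν ^ 2 := by
  have hsum : |∑ ν ∈ J, c ν * d ν| ≤ (∑ ν ∈ J, |c ν|) * J.card := by
    rw [Finset.sum_mul]
    refine (Finset.abs_sum_le_sum_abs _ _).trans (Finset.sum_le_sum fun ν hν => ?_)
    rw [abs_mul]
    gcongr
    exact hd ν hν
  have hcs := sq_sum_le_card_mul_sum_sq (s := J) (f := fun ν => |c ν|)
  simp only [sq_abs] at hcs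
  refine le_trans ?_ hcs
  rw [← sq_abs, abs_div, Nat.abs_cast]
  gcongr
  exact div_le_of_le_mul₀ (by positivity) (by positivity) hsum

theorem sum_sq_dirichletKernel_div_le (hN : 0 < N) (c : ℕ → ℝ) {x : ℕ → ℝ}
    (hx : ∀ k, x k ∈ Set.Icc (node N k) (node N (k + 1))) :
    ∑ k ∈ Finset.range N,
      ((∑ ν ∈ Finset.range N, c ν * dirichletKernel ν (x k)) / (N / ((k : ℝ) + 1))) ^ 2 ≤
      5 * N * ∑ ν ∈ Finset.range N, c ν ^ 2 := by
  set S := ∑ ν ∈ Finset.range N, c ν ^ 2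
  set V : ℕ → ℝ := fun k => ∑ ν ∈ Finset.range N, c ν * dirichletKernel ν (x k)
  set T : ℕ → ℝ := fun k => ∑ ν ∈ Finset.range N, c ν * sin (((ν : ℝ) + 1 / 2) * x k)
  have hVT : ∀ k, 2 * sin (x k / 2) * V k = T k := fun k => by
    simp only [V, T, Finset.mul_sum, ← two_sin_mul_dirichletKernel]
    exact Finset.sum_congr rfl fun ν _ => by ring
  have hpos : ∀ k ∈ Finset.range N, k ≠ 0 → (V k / (N / ((k : ℝ) + 1))) ^ 2 ≤ T k ^ 2 := by
    intro k hk hk0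
    have hsin := add_one_div_le_two_mul_sin (Finset.mem_range.1 hk) hk0 (hx k)
    rw [div_div_eq_mul_div, mul_div_assoc, mul_comm, ← hVT, mul_pow, mul_pow]
    gcongr
  have hzero : (V 0 / (N / (((0 : ℕ) : ℝ) + 1))) ^ 2 ≤ N * S := by
    rw [Nat.cast_zero, zero_add, div_one, ← Finset.card_range N]
    refine sq_sum_mul_div_card_le c fun ν hν => ?_
    simpa using abs_dirichletKernel_le_div hN (Finset.mem_range.1 hν) (hx 0)
  have hterm : ∀ k ∈ Finset.range N,
      (V k / (N / ((k : ℝ) + 1))) ^ 2 ≤ T k ^ 2 + if k = 0 then N * S else 0 := fun k hk => by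
    split_ifs with hk0
    · subst hk0
      exact hzero.trans (le_add_of_nonneg_left (sq_nonneg _))
    · simpa only [add_zero] using hpos k hk hk0
  refine (Finset.sum_le_sum hterm).trans ?_
  rw [Finset.sum_add_distrib, Finset.sum_ite_eq' _ 0, if_pos (Finset.mem_range.2 hN)]
  linarith [sum_sq_sin_le hN c hx]

end LargeSieve

section Duality

variable {ι κ : Type*} {J : Finset κ} {E : Finset ι} {e : κ → ℝ → ℝ} {a b : ι → ℝ} {g : ℝ → ℝ}

theorem integral_mul_sum_eq (he : ∀ ν, Continuous (e ν)) {u v : ℝ}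
    (hg : IntervalIntegrable g volume u v) (c : κ → ℝ) :
    ∫ t in u..v, g t * ∑ ν ∈ J, c ν * e ν t = ∑ ν ∈ J, c ν * ∫ t in u..v, g t * e ν t := by
  simp only [← intervalIntegral.integral_const_mul]
  rw [← intervalIntegral.integral_finsetSum fun ν _ =>
    (hg.mul_continuousOn (he ν).continuousOn).const_mul _]
  refine intervalIntegral.integral_congr fun t _ => ?_
  simp only [Finset.mul_sum]
  exact Finset.sum_congr rfl fun ν _ => by ring

theorem integral_mul_le_of_abs_le {V : ℝ → ℝ} {u v M : ℝ} (huv : u ≤ v) (hV : Continuous V)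
    (hg : IntervalIntegrable g volume u v) (hM : ∀ t ∈ Set.Icc u v, |V t| ≤ M) :
    |∫ t in u..v, g t * V t| ≤ (∫ t in u..v, |g t|) * M := by
  rw [← intervalIntegral.integral_mul_const]
  refine (intervalIntegral.abs_integral_le_integral_abs huv).trans
    (intervalIntegral.integral_mono_on huv (hg.mul_continuousOn hV.continuousOn).abs
      (hg.abs.mul_const _) fun t ht => ?_)
  rw [abs_mul]
  gcongr
  exact hM t ht

/-- A sampling inequality, valid for every choice of one sample point in each interval, dualizes to
an inequality for the coefficients of `g`: sample where `|∑ ν, c ν * e ν|` is largest. -/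
theorem sum_sq_sum_integral_le_of_sum_sq_le (he : ∀ ν, Continuous (e ν)) (hab : ∀ k, a k ≤ b k)
    {w : ι → ℝ} (hw : ∀ k, 0 < w k) {B : ℝ} (hB : 0 ≤ B)
    (hsample : ∀ (c : κ → ℝ) (x : ι → ℝ), (∀ k, x k ∈ Set.Icc (a k) (b k)) →
      ∑ k ∈ E, ((∑ ν ∈ J, c ν * e ν (x k)) / w k) ^ 2 ≤ B * ∑ ν ∈ J, c ν ^ 2)
    (hg : ∀ k, IntervalIntegrable g volume (a k) (b k)) :
    ∑ ν ∈ J, (∑ k ∈ E, ∫ t in a k..b k, g t * e ν t) ^ 2 ≤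
      B * ∑ k ∈ E, (w k * ∫ t in a k..b k, |g t|) ^ 2 := by
  set c : κ → ℝ := fun ν => ∑ k ∈ E, ∫ t in a k..b k, g t * e ν t
  set V : ℝ → ℝ := fun t => ∑ ν ∈ J, c ν * e ν t
  set A := ∑ k ∈ E, (w k * ∫ t in a k..b k, |g t|) ^ 2
  set S := ∑ ν ∈ J, c ν ^ 2
  have hV : Continuous V := by fun_prop
  choose x hx hmax using fun k =>
    isCompact_Icc.exists_isMaxOn (Set.nonempty_Icc.2 (hab k)) hV.abs.continuousOn
  have hpair : S ≤ ∑ k ∈ E, (w k * ∫ t in a k..b k, |g t|) * |V (x k) / w k| := by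
    have hswap : S = ∑ k ∈ E, ∫ t in a k..b k, g t * V t := by
      simp only [V, integral_mul_sum_eq he (hg _)]
      rw [Finset.sum_comm]
      exact Finset.sum_congr rfl fun ν _ => by rw [← Finset.mul_sum, sq]
    rw [hswap]
    refine Finset.sum_le_sum fun k _ => ?_
    calc ∫ t in a k..b k, g t * V t ≤ (∫ t in a k..b k, |g t|) * |V (x k)| :=
          (le_abs_self _).trans (integral_mul_le_of_abs_le (hab k) hV (hg k) fun t ht => hmax k ht)
      _ = (w k * ∫ t in a k..b k, |g t|) * |V (x k) / w k| := by
          have := hw k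
          rw [abs_div, abs_of_pos this]
          field_simp
  have hS0 : 0 ≤ S := Finset.sum_nonneg fun ν _ => sq_nonneg _
  have hA0 : 0 ≤ A := Finset.sum_nonneg fun k _ => sq_nonneg _
  have hcs : S * S ≤ B * A * S :=
    calc S * S ≤ (∑ k ∈ E, (w k * ∫ t in a k..b k, |g t|) * |V (x k) / w k|) ^ 2 := by
          rw [← sq]; gcongr
      _ ≤ A * ∑ k ∈ E, |V (x k) / w k| ^ 2 := Finset.sum_mul_sq_le_sq_mul_sq _ _ _
      _ ≤ A * (B * S) := by
          simp only [sq_abs]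
          gcongr
          exact hsample c x hx
      _ = B * A * S := by ring
  rcases hS0.eq_or_lt with h | h
  · exact h ▸ mul_nonneg hB hA0
  · exact le_of_mul_le_mul_right hcs h

end Duality

section NearPart

variable {φ : ℝ → ℝ} {τ : ℝ} {N : ℕ}

theorem logPsi_average_le {a b : ℝ} (hab : a < b) (hφ : IntervalIntegrable φ volume a b)
    (hψ : IntervalIntegrable (fun t => logPsi |φ t|) volume a b) :
    logPsi (⨍ t in a..b, |φ t|) ≤ ⨍ t in a..b, logPsi |φ t| := by
  rw [Set.uIoc_of_le hab.le]
  refine convexOn_logPsi.map_set_average_le continuous_logPsi.continuousOn isClosed_Ici ?_ ?_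
    (ae_of_all _ fun t => abs_nonneg (φ t)) hφ.abs.1 hψ.1
  · simpa using hab
  · simp

theorem sum_logPsi_average_le (hN : 0 < N) (hφ : ∀ a b, IntervalIntegrable φ volume a b)
    (hψ : ∀ a b, IntervalIntegrable (fun t => logPsi |φ t|) volume a b)
    (h : ∀ u, 0 ≤ u → ∫ t in (0 : ℝ)..u, logPsi |φ t| ≤ τ * u) (K : ℕ) :
    ∑ k ∈ Finset.range K, logPsi (⨍ t in node N k..node N (k + 1), |φ t|) ≤ τ * K := by
  calc ∑ k ∈ Finset.range K, logPsi (⨍ t in node N k..node N (k + 1), |φ t|)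
      ≤ ∑ k ∈ Finset.range K, (π / N)⁻¹ * ∫ t in node N k..node N (k + 1), logPsi |φ t| := by
        refine Finset.sum_le_sum fun k _ =>
          (logPsi_average_le (node_lt_succ hN k) (hφ _ _) (hψ _ _)).trans_eq ?_
        rw [interval_average_eq, node_succ_sub, smul_eq_mul]
    _ = (π / N)⁻¹ * ∫ t in (0 : ℝ)..node N K, logPsi |φ t| := by
        rw [← Finset.mul_sum,
          intervalIntegral.sum_integral_adjacent_intervals fun k _ => hψ _ _, node_zero]
    _ ≤ (π / N)⁻¹ * (τ * node N K) := by
        gcongr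
        exact h _ (node_nonneg N K)
    _ = τ * K := by unfold node; field_simp

theorem abs_integral_mul_dirichletKernel_le (hφ : ∀ a b, IntervalIntegrable φ volume a b)
    {k ν : ℕ} (hk : k < N) (hν : ν < N) :
    |∫ t in node N k..node N (k + 1), φ t * dirichletKernel ν t| ≤
      N / ((k : ℝ) + 1) * ∫ t in node N k..node N (k + 1), |φ t| := by
  rw [mul_comm]
  exact integral_mul_le_of_abs_le (node_lt_succ (by omega) k).le (continuous_dirichletKernel ν)
    (hφ _ _) fun t ht => abs_dirichletKernel_le_div hk hν ht

theorem sum_sq_sum_integral_dirichletKernel_le (hN : 0 < N)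
    (hφ : ∀ a b, IntervalIntegrable φ volume a b) {E : Finset ℕ} (hE : E ⊆ Finset.range N) :
    ∑ ν ∈ Finset.range N,
      (∑ k ∈ E, ∫ t in node N k..node N (k + 1), φ t * dirichletKernel ν t) ^ 2 ≤
      5 * N * ∑ k ∈ E, (N / ((k : ℝ) + 1) * ∫ t in node N k..node N (k + 1), |φ t|) ^ 2 :=
  sum_sq_sum_integral_le_of_sum_sq_le continuous_dirichletKernel
    (fun k => (node_lt_succ hN k).le) (fun k => by positivity) (by positivity)
    (fun c x hx => (Finset.sum_le_sum_of_subset_of_nonneg hE fun _ _ _ => sq_nonneg _).trans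
      (sum_sq_dirichletKernel_div_le hN c hx)) fun k => hφ _ _

theorem sum_rpow_integral_le (hN : 0 < N) (hφ : ∀ a b, IntervalIntegrable φ volume a b)
    (hψ : ∀ a b, IntervalIntegrable (fun t => logPsi |φ t|) volume a b)
    (hτ : 0 < τ) (hτ1 : τ ≤ 1) (h : ∀ u, 0 ≤ u → ∫ t in (0 : ℝ)..u, logPsi |φ t| ≤ τ ^ 2 * u)
    {s : ℝ} (hs : 0 < s) (hs1 : s ≤ 1) :
    ∑ k ∈ Finset.range N,
      (3 * (N / ((k : ℝ) + 1) * ∫ t in node N k..node N (k + 1), |φ t|)) ^ (1 + s) ≤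
      13400 * τ / s := by
  set m : ℕ → ℝ := fun k => ⨍ t in node N k..node N (k + 1), |φ t|
  have havg : ∀ k, m k = (π / N)⁻¹ * ∫ t in node N k..node N (k + 1), |φ t| := fun k => by
    dsimp only [m]
    rw [interval_average_eq, node_succ_sub, smul_eq_mul]
  have hm0 : ∀ k, 0 ≤ m k := fun k => by
    rw [havg]
    exact mul_nonneg (by positivity) (intervalIntegral.integral_nonneg_of_forall
      (node_lt_succ hN k).le fun _ => abs_nonneg _)
  have hscale : ∀ k : ℕ, 3 * (N / ((k : ℝ) + 1) * ∫ t in node N k..node N (k + 1), |φ t|) =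
      3 * π * (m k / ((k : ℝ) + 1)) := fun k => by
    rw [havg]
    field_simp
  have hconst : (3 * π) ^ (1 + s) ≤ 100 := by
    calc (3 * π) ^ (1 + s) ≤ 10 ^ (1 + s) := by gcongr; linarith [pi_lt_d2]
      _ ≤ 10 ^ (2 : ℝ) := rpow_le_rpow_of_exponent_le (by norm_num) (by linarith)
      _ = 100 := by norm_num
  calc _ = ∑ k ∈ Finset.range N, (3 * π) ^ (1 + s) * (m k / ((k : ℝ) + 1)) ^ (1 + s) :=
        Finset.sum_congr rfl fun k _ => by
          rw [hscale, mul_rpow (by positivity) (div_nonneg (hm0 k) (by positivity))]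
    _ = (3 * π) ^ (1 + s) * ∑ k ∈ Finset.range N, (m k / ((k : ℝ) + 1)) ^ (1 + s) := by
        rw [Finset.mul_sum]
    _ ≤ 100 * (134 * τ / s) := by
        have hnonneg : ∀ k, 0 ≤ m k / ((k : ℝ) + 1) := fun k => div_nonneg (hm0 k) (by positivity)
        gcongr
        · exact Finset.sum_nonneg fun k _ => rpow_nonneg (hnonneg k) _
        · exact sum_rpow_div_le hm0 hτ hτ1 (sum_logPsi_average_le hN hφ hψ h) hs hs1 N
    _ = 13400 * τ / s := by ring

theorem sum_expPhi_integral_le (hN : 0 < N) (hφ : ∀ a b, IntervalIntegrable φ volume a b)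
    (hψ : ∀ a b, IntervalIntegrable (fun t => logPsi |φ t|) volume a b)
    (hτ : 0 < τ) (hsmall : 13400 * τ ≤ 1 / 36)
    (h : ∀ u, 0 ≤ u → ∫ t in (0 : ℝ)..u, logPsi |φ t| ≤ τ ^ 2 * u) :
    ∑ ν ∈ Finset.range N, expPhi |∫ t in (0 : ℝ)..π, φ t * dirichletKernel ν t| ≤
      N * (217 * (13400 * τ)) := by
  have hsplit : ∀ ν, ∫ t in (0 : ℝ)..π, φ t * dirichletKernel ν t =
      ∑ k ∈ Finset.range N, ∫ t in node N k..node N (k + 1), φ t * dirichletKernel ν t :=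
    fun ν => by
      rw [intervalIntegral.sum_integral_adjacent_intervals fun k _ =>
        (hφ _ _).mul_continuousOn (by fun_prop), node_zero, node_self hN]
  set a : ℕ → ℝ := fun k => N / ((k : ℝ) + 1) * ∫ t in node N k..node N (k + 1), |φ t|
  have ha : ∀ k, 0 ≤ a k := fun k => mul_nonneg (by positivity)
    (intervalIntegral.integral_nonneg_of_forall (node_lt_succ hN k).le fun _ => abs_nonneg _)
  simp only [hsplit]
  refine (sum_expPhi_abs_sum_le (a := fun k => 3 * a k) (fun k _ => by linarith [ha k])
    (by positivity) hsmall
    (fun s hs hs1 => sum_rpow_integral_le hN hφ hψ hτ (by linarith) h hs hs1)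
    (fun k hk ν hν => ?_) fun E hE => ?_).trans_eq (by rw [Finset.card_range])
  · linarith [ha k, abs_integral_mul_dirichletKernel_le hφ (Finset.mem_range.1 hk)
      (Finset.mem_range.1 hν)]
  · have hnonneg : 0 ≤ N * ∑ k ∈ E, a k ^ 2 :=
      mul_nonneg N.cast_nonneg (Finset.sum_nonneg fun k _ => sq_nonneg _)
    simp only [mul_pow, ← Finset.mul_sum, Finset.card_range]
    linarith [sum_sq_sum_integral_dirichletKernel_le hN hφ hE]

end NearPart

section OrliczClass

variable {f g h : ℝ → ℝ}

theorem MemLPsi.intervalIntegrable_logPsi (hf : MemLPsi logPsi f) (a b : ℝ) :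
    IntervalIntegrable (fun t => logPsi |f t|) volume a b := by
  have hper : Function.Periodic (fun t => logPsi |f t|) (2 * π) :=
    hf.periodic.comp fun y => logPsi |y|
  refine hper.intervalIntegrable two_pi_pos.ne' (t := -π) ?_ a b
  rw [show -π + 2 * π = π by ring,
    intervalIntegrable_iff_integrableOn_Icc_of_le (by linarith [pi_pos])]
  exact hf.integrableOn

theorem MemLPsi.intervalIntegrable (hf : MemLPsi logPsi f) (a b : ℝ) :
    IntervalIntegrable f volume a b := by
  refine ((intervalIntegrable_const (c := expPhi 1)).add
    (hf.intervalIntegrable_logPsi a b)).mono_fun'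
    hf.aemeasurable.aestronglyMeasurable.restrict (ae_of_all _ fun t => ?_)
  simpa only [one_mul, norm_eq_abs] using mul_le_expPhi_add_logPsi zero_le_one (abs_nonneg (f t))

theorem intervalIntegrable_logPsi_abs_add {a b : ℝ} (hg : IntervalIntegrable g volume a b)
    (hh : IntervalIntegrable h volume a b)
    (hΨg : IntervalIntegrable (fun t => logPsi |g t|) volume a b)
    (hΨh : IntervalIntegrable (fun t => logPsi |h t|) volume a b) :
    IntervalIntegrable (fun t => logPsi |g t + h t|) volume a b := by
  refine ((hΨg.const_mul 2).add (hΨh.const_mul 2)).mono_fun'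
    ((continuous_logPsi.comp continuous_abs).comp_aestronglyMeasurable
      (hg.add hh).aestronglyMeasurable_restrict_uIoc) (ae_of_all _ fun t => ?_)
  dsimp only
  rw [norm_of_nonneg (logPsi_nonneg _)]
  exact logPsi_abs_add_le (g t) (h t)

theorem MemLPsi.intervalIntegrable_logPsi_sub_const (hf : MemLPsi logPsi f) (r a b : ℝ) :
    IntervalIntegrable (fun t => logPsi |f t - r|) volume a b := by
  simp only [sub_eq_add_neg]
  exact intervalIntegrable_logPsi_abs_add (hf.intervalIntegrable a b) intervalIntegrable_const
    (hf.intervalIntegrable_logPsi a b) intervalIntegrable_const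

theorem intervalIntegrable_comp_const_add (hh : ∀ a b, IntervalIntegrable h volume a b)
    (x a b : ℝ) : IntervalIntegrable (fun t => h (x + t)) volume a b := by
  simpa using (hh (x + a) (x + b)).comp_add_left x

theorem intervalIntegrable_comp_const_sub (hh : ∀ a b, IntervalIntegrable h volume a b)
    (x a b : ℝ) : IntervalIntegrable (fun t => h (x - t)) volume a b := by
  simpa using (hh (x - a) (x - b)).comp_sub_left x

theorem intervalIntegrable_symmDiff₂ (hf : ∀ a b, IntervalIntegrable f volume a b) (x a b : ℝ) :
    IntervalIntegrable (symmDiff₂ f x) volume a b :=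
  ((intervalIntegrable_comp_const_add hf x a b).add
    (intervalIntegrable_comp_const_sub hf x a b)).sub intervalIntegrable_const

theorem MemLPsi.intervalIntegrable_logPsi_symmDiff₂ (hf : MemLPsi logPsi f) (x a b : ℝ) :
    IntervalIntegrable (fun t => logPsi |symmDiff₂ f x t|) volume a b := by
  simp only [symmDiff₂, add_sub_assoc]
  exact intervalIntegrable_logPsi_abs_add
    (intervalIntegrable_comp_const_add hf.intervalIntegrable x a b)
    ((intervalIntegrable_comp_const_sub hf.intervalIntegrable x a b).sub intervalIntegrable_const)
    (intervalIntegrable_comp_const_add hf.intervalIntegrable_logPsi x a b)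
    (intervalIntegrable_comp_const_sub (hf.intervalIntegrable_logPsi_sub_const _) x a b)

end OrliczClass

section PartialSums

variable {f g : ℝ → ℝ}

theorem partialSum_succ (f : ℝ → ℝ) (ν : ℕ) (x : ℝ) :
    partialSum f (ν + 1) x = partialSum f ν x +
      (cosCoeff f (ν + 1) * cos ((ν + 1 : ℕ) * x) +
        sinCoeff f (ν + 1) * sin ((ν + 1 : ℕ) * x)) := by
  rw [partialSum, partialSum, Finset.sum_Icc_succ_top (by omega), add_assoc]

theorem partialSum_eq_integral (hf : IntervalIntegrable f volume (-π) π) (ν : ℕ) (x : ℝ) :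
    partialSum f ν x = 1 / π * ∫ u in (-π)..π, f u * dirichletKernel ν (u - x) := by
  induction ν with
  | zero =>
    simp only [partialSum, cosCoeff, dirichletKernel_zero, Nat.cast_zero, zero_mul, cos_zero,
      mul_one, intervalIntegral.integral_mul_const, Finset.Icc_eq_empty_of_lt zero_lt_one,
      Finset.sum_empty, add_zero]
    ring
  | succ n ih =>
    have hkernel : ∀ u, f u * dirichletKernel (n + 1) (u - x) = f u * dirichletKernel n (u - x) +
        (f u * cos ((n + 1 : ℕ) * u) * cos ((n + 1 : ℕ) * x) +
          f u * sin ((n + 1 : ℕ) * u) * sin ((n + 1 : ℕ) * x)) := fun u => by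
      rw [dirichletKernel_succ, mul_sub, cos_sub]
      push_cast
      ring
    have hcos : IntervalIntegrable (fun u => f u * cos ((n + 1 : ℕ) * u)) volume (-π) π :=
      hf.mul_continuousOn (by fun_prop)
    have hsin : IntervalIntegrable (fun u => f u * sin ((n + 1 : ℕ) * u)) volume (-π) π :=
      hf.mul_continuousOn (by fun_prop)
    simp only [hkernel]
    rw [partialSum_succ, ih, intervalIntegral.integral_add (hf.mul_continuousOn (by fun_prop))
      ((hcos.mul_const _).add (hsin.mul_const _)),
      intervalIntegral.integral_add (hcos.mul_const _) (hsin.mul_const _),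
      intervalIntegral.integral_mul_const, intervalIntegral.integral_mul_const]
    unfold cosCoeff sinCoeff
    ring

theorem periodic_dirichletKernel (ν : ℕ) : Function.Periodic (dirichletKernel ν) (2 * π) :=
  fun t => by simp only [dirichletKernel, mul_add, cos_add_nat_mul_two_pi]

theorem integral_mul_dirichletKernel_sub (hper : Function.Periodic f (2 * π)) (ν : ℕ)
    (x : ℝ) : ∫ u in (-π)..π, f u * dirichletKernel ν (u - x) =
      ∫ t in (-π)..π, f (x + t) * dirichletKernel ν t := by
  have hprod : Function.Periodic (fun t => f (x + t) * dirichletKernel ν t) (2 * π) :=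
    (hper.const_add x).mul (periodic_dirichletKernel ν)
  have hshift := hprod.intervalIntegral_add_eq (-π - x) (-π)
  rw [show -π - x + 2 * π = π - x by ring, show -π + 2 * π = π by ring] at hshift
  rw [← hshift, ← intervalIntegral.integral_comp_sub_right
    (fun t => f (x + t) * dirichletKernel ν t) x]
  simp only [add_sub_cancel]

theorem integral_mul_dirichletKernel_eq (hg : ∀ a b, IntervalIntegrable g volume a b) (ν : ℕ) :
    ∫ t in (-π)..π, g t * dirichletKernel ν t =
      ∫ t in (0 : ℝ)..π, (g t + g (-t)) * dirichletKernel ν t := by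
  have hright : ∀ a b, IntervalIntegrable (fun t => g t * dirichletKernel ν t) volume a b :=
    fun a b => (hg a b).mul_continuousOn (by fun_prop)
  have hleft : IntervalIntegrable (fun t => g (-t) * dirichletKernel ν t) volume 0 π := by
    simpa only [zero_sub] using
      (intervalIntegrable_comp_const_sub hg 0 0 π).mul_continuousOn (by fun_prop)
  have hneg := intervalIntegral.integral_comp_neg (fun t => g t * dirichletKernel ν t)
    (a := 0) (b := π)
  simp only [dirichletKernel_neg, neg_zero] at hneg
  rw [← intervalIntegral.integral_add_adjacent_intervals (hright (-π) 0) (hright 0 π), ← hneg,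
    add_comm, ← intervalIntegral.integral_add (hright 0 π) hleft]
  simp only [add_mul]

theorem partialSum_sub_eq_integral (hper : Function.Periodic f (2 * π))
    (hf : ∀ a b, IntervalIntegrable f volume a b) (ν : ℕ) (x : ℝ) :
    partialSum f ν x - f x =
      1 / π * ∫ t in (0 : ℝ)..π, symmDiff₂ f x t * dirichletKernel ν t := by
  have hsum : IntervalIntegrable (fun t => (f (x + t) + f (x - t)) * dirichletKernel ν t)
      volume 0 π :=
    ((intervalIntegrable_comp_const_add hf x 0 π).add
      (intervalIntegrable_comp_const_sub hf x 0 π)).mul_continuousOn (by fun_prop)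
  simp only [symmDiff₂, sub_mul _ (2 * f x)]
  rw [intervalIntegral.integral_sub hsum (Continuous.intervalIntegrable (by fun_prop) _ _),
    intervalIntegral.integral_const_mul, integral_dirichletKernel, partialSum_eq_integral (hf _ _),
    integral_mul_dirichletKernel_sub hper,
    integral_mul_dirichletKernel_eq (intervalIntegrable_comp_const_add hf x)]
  simp only [← sub_eq_add_neg]
  field_simp

end PartialSums

section RiemannLebesgue

theorem tendsto_integral_mul_sin_cocompact {G : ℝ → ℝ} (hG : Integrable G) :
    Tendsto (fun w : ℝ => ∫ t, G t * sin (2 * π * (t * w))) (cocompact ℝ) (𝓝 0) := by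
  have hexp := (Complex.continuous_im.tendsto _).comp
    (tendsto_integral_exp_smul_cocompact fun t => (G t : ℂ))
  rw [Complex.zero_im] at hexp
  rw [← neg_zero]
  refine hexp.neg.congr fun w => ?_
  have hpointwise : ∀ t : ℝ, fourierChar (-(t * w)) • (G t : ℂ) =
      Complex.exp ((-(2 * π * (t * w)) : ℝ) * Complex.I) * (G t : ℂ) := fun t => by
    rw [Circle.smul_def, fourierChar_apply, smul_eq_mul, mul_neg]
  have hint : Integrable fun t : ℝ =>
      Complex.exp ((-(2 * π * (t * w)) : ℝ) * Complex.I) * (G t : ℂ) :=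
    hG.ofReal.bdd_mul (c := 1) (Continuous.aestronglyMeasurable (by fun_prop))
      (ae_of_all _ fun t => by rw [Complex.norm_exp_ofReal_mul_I])
  simp only [Function.comp_apply, hpointwise]
  rw [← Complex.imCLM_apply, ← Complex.imCLM.integral_comp_comm hint, ← integral_neg]
  refine integral_congr_ae (ae_of_all _ fun t => ?_)
  simp only [Complex.imCLM_apply, Complex.im_mul_ofReal, Complex.exp_ofReal_mul_I_im, sin_neg]
  ring

theorem tendsto_integral_mul_sin {G : ℝ → ℝ} (hG : Integrable G) :
    Tendsto (fun ν : ℕ => ∫ t, G t * sin (((ν : ℝ) + 1 / 2) * t)) atTop (𝓝 0) := by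
  have hfreq : Tendsto (fun ν : ℕ => ((ν : ℝ) + 1 / 2) / (2 * π)) atTop (cocompact ℝ) :=
    ((tendsto_atTop_add_const_right _ _ tendsto_natCast_atTop_atTop).atTop_div_const
      two_pi_pos).mono_right atTop_le_cocompact
  refine ((tendsto_integral_mul_sin_cocompact hG).comp hfreq).congr fun ν => ?_
  refine integral_congr_ae (ae_of_all _ fun t => ?_)
  dsimp only
  congr 2
  field_simp

theorem tendsto_integral_mul_dirichletKernel {φ : ℝ → ℝ} {δ : ℝ} (hδ : 0 < δ) (hδπ : δ ≤ π)
    (hφ : IntervalIntegrable φ volume δ π) :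
    Tendsto (fun ν : ℕ => ∫ t in δ..π, φ t * dirichletKernel ν t) atTop (𝓝 0) := by
  have hsin : ∀ t ∈ Set.uIcc δ π, 2 * sin (t / 2) ≠ 0 := fun t ht => by
    rw [Set.uIcc_of_le hδπ] at ht
    have := sin_pos_of_pos_of_lt_pi (x := t / 2) (by linarith [ht.1])
      (by linarith [ht.2, pi_pos])
    positivity
  have hG : IntervalIntegrable (fun t => φ t * (2 * sin (t / 2))⁻¹) volume δ π :=
    hφ.mul_continuousOn (ContinuousOn.inv₀ (by fun_prop) hsin)
  refine (tendsto_integral_mul_sin ((integrable_indicator_iff measurableSet_Ioc).2 hG.1)).congr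
    fun ν => ?_
  simp_rw [← Set.indicator_mul_left _ _ fun t => sin (((ν : ℝ) + 1 / 2) * t)]
  rw [integral_indicator measurableSet_Ioc, ← intervalIntegral.integral_of_le hδπ]
  refine intervalIntegral.integral_congr fun t ht => ?_
  rw [← two_sin_mul_dirichletKernel, mul_assoc, inv_mul_cancel_left₀ (hsin t ht)]

end RiemannLebesgue

section Averages

theorem tendsto_div_nhdsGT_zero_of_monotoneOn {F : ℝ → ℝ} {c : ℝ} (hc : 0 < c) (hF0 : 0 ≤ F 0)
    (hF : MonotoneOn F (Set.Ici 0))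
    (hlim : Tendsto (fun m : ℕ => F (c / m) / (c / m)) atTop (𝓝 0)) :
    Tendsto (fun u => F u / u) (𝓝[>] 0) (𝓝 0) := by
  have hfloor : Tendsto (fun u : ℝ => ⌊c * u⁻¹⌋₊) (𝓝[>] 0) atTop :=
    tendsto_nat_floor_atTop.comp (tendsto_inv_nhdsGT_zero.const_mul_atTop hc)
  have hF_nonneg : ∀ u, 0 ≤ u → 0 ≤ F u := fun u hu => hF0.trans (hF Set.self_mem_Ici hu hu)
  refine squeeze_zero' ?_ ?_ (by simpa using (hlim.comp hfloor).const_mul 2)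
  · filter_upwards [self_mem_nhdsWithin] with u hu
    exact div_nonneg (hF_nonneg u hu.le) hu.le
  filter_upwards [Ioc_mem_nhdsGT hc] with u ⟨hu, huc⟩
  set m := ⌊c * u⁻¹⌋₊ with hm
  have hm_pos : 1 ≤ m := Nat.le_floor (by
    rw [Nat.cast_one, ← div_eq_mul_inv, one_le_div hu]
    exact huc)
  have hm_pos' : (1 : ℝ) ≤ m := Nat.one_le_cast.2 hm_pos
  have hle : u ≤ c / m := by
    have := Nat.floor_le (show 0 ≤ c * u⁻¹ by positivity)
    rwa [← hm, ← div_eq_mul_inv, le_div_comm₀ (by positivity) hu] at this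
  have hle_two_mul : c / m ≤ 2 * u := by
    have := Nat.lt_floor_add_one (c * u⁻¹)
    rw [← hm, ← div_eq_mul_inv, div_lt_iff₀ hu] at this
    rw [div_le_iff₀ (by positivity)]
    nlinarith
  calc F u / u ≤ F (c / m) / u := by
        gcongr
        exact hF hu.le (hu.le.trans hle) hle
    _ ≤ F (c / m) / (c / m / 2) := by
        refine div_le_div_of_nonneg_left (hF_nonneg _ (by positivity)) (by positivity) ?_
        linarith
    _ = 2 * (F (c / m) / (c / m)) := by field_simp

theorem tendsto_div_natCast_add_one_nhdsGT_zero {c : ℝ} (hc : 0 < c) :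
    Tendsto (fun n : ℕ => c / ((n : ℝ) + 1)) atTop (𝓝[>] 0) :=
  tendsto_nhdsWithin_iff.2 ⟨tendsto_const_nhds.div_atTop
    (tendsto_atTop_add_const_right _ _ tendsto_natCast_atTop_atTop),
    .of_forall fun n => Set.mem_Ioi.2 (by positivity)⟩

theorem tendsto_sum_mul_comp_div {w : ℕ → ℝ} {e : ℝ → ℝ} {c M : ℝ} (hc : 0 < c)
    (hw : Summable w) (he : ∀ u ∈ Set.Ioc 0 c, |e u| ≤ M)
    (hlim : Tendsto e (𝓝[>] 0) (𝓝 0)) :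
    Tendsto (fun n : ℕ => ∑ k ∈ Finset.range (n + 1), w k * e (c * ((k : ℝ) + 1) / ((n : ℝ) + 1)))
      atTop (𝓝 0) := by
  have hM : 0 ≤ M := (abs_nonneg _).trans (he c ⟨hc, le_rfl⟩)
  refine Tendsto.congr (fun n => (sum_eq_tsum_indicator _ (Finset.range (n + 1))).symm) ?_
  rw [← tsum_zero (β := ℕ)]
  refine tendsto_tsum_of_dominated_convergence (hw.abs.mul_right M) (fun k => ?_)
    (.of_forall fun n k => ?_)
  · have hterm := (hlim.comp (tendsto_div_natCast_add_one_nhdsGT_zero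
      (c := c * ((k : ℝ) + 1)) (by positivity))).const_mul (w k)
    rw [mul_zero] at hterm
    refine hterm.congr' ?_
    filter_upwards [eventually_ge_atTop k] with n hn
    rw [Set.indicator_of_mem (Finset.mem_coe.2 (Finset.mem_range_succ_iff.2 hn)),
      Function.comp_apply]
  · by_cases hk : k ∈ Finset.range (n + 1)
    · have hkn : (k : ℝ) ≤ n := Nat.cast_le.2 (Finset.mem_range_succ_iff.1 hk)
      rw [Set.indicator_of_mem (Finset.mem_coe.2 hk), norm_mul]
      refine mul_le_mul_of_nonneg_left (he _ ⟨by positivity, ?_⟩) (norm_nonneg _)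
      rw [div_le_iff₀ (by positivity)]
      gcongr
    · rw [Set.indicator_of_notMem (by simpa using hk), norm_zero]
      positivity

end Averages

section PointModulus

variable {f : ℝ → ℝ} {x : ℝ}

theorem integral_logPsi_symmDiff₂_nonneg (f : ℝ → ℝ) (x : ℝ) {u : ℝ} (hu : 0 ≤ u) :
    0 ≤ ∫ t in (0 : ℝ)..u, logPsi |symmDiff₂ f x t| :=
  intervalIntegral.integral_nonneg_of_forall hu fun _ => logPsi_nonneg _

theorem logPsi_pointModulus (f : ℝ → ℝ) (x : ℝ) {u : ℝ} (hu : 0 ≤ u) :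
    logPsi (pointModulus logPsi f x u) = (∫ t in (0 : ℝ)..u, logPsi |symmDiff₂ f x t|) / u := by
  rw [pointModulus, map_nInv surjOn_logPsi (mul_nonneg (by positivity)
    (integral_logPsi_symmDiff₂_nonneg f x hu)), one_div_mul_eq_div]

theorem MemLPsi.monotoneOn_integral_logPsi_symmDiff₂ (hf : MemLPsi logPsi f) (x : ℝ) :
    MonotoneOn (fun u => ∫ t in (0 : ℝ)..u, logPsi |symmDiff₂ f x t|) (Set.Ici 0) :=
  fun _ hu _ _ huv => intervalIntegral.integral_mono_interval le_rfl hu huv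
    (ae_of_all _ fun _ => logPsi_nonneg _) (hf.intervalIntegrable_logPsi_symmDiff₂ x _ _)

theorem IsLPsiPoint.tendsto_integral_div (hf : MemLPsi logPsi f) (hx : IsLPsiPoint logPsi f x) :
    Tendsto (fun u => (∫ t in (0 : ℝ)..u, logPsi |symmDiff₂ f x t|) / u) (𝓝[>] 0) (𝓝 0) := by
  refine tendsto_div_nhdsGT_zero_of_monotoneOn pi_pos
    (integral_logPsi_symmDiff₂_nonneg f x le_rfl) (hf.monotoneOn_integral_logPsi_symmDiff₂ x)
    ((tendsto_add_atTop_iff_nat 1).1 ?_)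
  have hΨ := (continuous_logPsi.tendsto 0).comp hx
  rw [logPsi_zero] at hΨ
  refine hΨ.congr fun n => ?_
  rw [Function.comp_apply, logPsi_pointModulus f x (by positivity), Nat.cast_add_one]

theorem IsLPsiPoint.exists_integral_le (hf : MemLPsi logPsi f) (hx : IsLPsiPoint logPsi f x)
    {ε : ℝ} (hε : 0 < ε) : ∃ δ ∈ Set.Ioc 0 π, ∀ u ∈ Set.Icc 0 δ,
      ∫ t in (0 : ℝ)..u, logPsi |symmDiff₂ f x t| ≤ ε * u := by
  obtain ⟨δ, hδ, hsub⟩ := mem_nhdsGT_iff_exists_Ioc_subset.1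
    ((hx.tendsto_integral_div hf).eventually_lt_const hε)
  refine ⟨min δ π, ⟨lt_min hδ pi_pos, min_le_right _ _⟩, fun u hu => ?_⟩
  rcases hu.1.eq_or_lt with rfl | hu_pos
  · rw [intervalIntegral.integral_same, mul_zero]
  · exact (div_le_iff₀ hu_pos).1 (hsub ⟨hu_pos, hu.2.trans (min_le_left _ _)⟩).le

theorem IsLPsiPoint.exists_integral_div_le (hf : MemLPsi logPsi f)
    (hx : IsLPsiPoint logPsi f x) : ∃ M, ∀ u ∈ Set.Ioc 0 π,
      (∫ t in (0 : ℝ)..u, logPsi |symmDiff₂ f x t|) / u ≤ M := by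
  obtain ⟨δ, hδ, hsmall⟩ := hx.exists_integral_le hf one_pos
  refine ⟨max 1 ((∫ t in (0 : ℝ)..π, logPsi |symmDiff₂ f x t|) / δ), fun u hu => ?_⟩
  rcases le_total u δ with huδ | hδu
  · exact le_max_of_le_left ((div_le_iff₀ hu.1).2 (hsmall u ⟨hu.1.le, huδ⟩))
  · exact le_max_of_le_right (div_le_div₀ (integral_logPsi_symmDiff₂_nonneg f x pi_pos.le)
      (hf.monotoneOn_integral_logPsi_symmDiff₂ x hu.1.le pi_pos.le hu.2) hδ.1 hδu)

end PointModulus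

section Characteristic

theorem deriv_logPsi_one_div_nonneg (k : ℕ) : 0 ≤ deriv logPsi (1 / ((k : ℝ) + 1)) := by
  rw [deriv_logPsi (by positivity)]
  exact log_nonneg (le_add_of_nonneg_right (by positivity))

theorem deriv_logPsi_le {t : ℝ} (ht : 0 < t) : deriv logPsi t ≤ t := by
  rw [deriv_logPsi ht]
  linarith [log_le_sub_one_of_pos (show 0 < 1 + t by positivity)]

theorem summable_deriv_logPsi_div_sqrt :
    Summable fun k : ℕ => deriv logPsi (1 / ((k : ℝ) + 1)) / √((k : ℝ) + 1) := by
  have hrpow : Summable fun k : ℕ => ((k : ℝ) + 1) ^ (-(1 + 1 / 2) : ℝ) :=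
    summable_of_sum_range_le (fun k => by positivity) (sum_rpow_le one_half_pos)
  refine hrpow.of_nonneg_of_le (fun k => div_nonneg (deriv_logPsi_one_div_nonneg k)
    (sqrt_nonneg _)) fun k => ?_
  have hk : (0 : ℝ) < (k : ℝ) + 1 := by positivity
  calc deriv logPsi (1 / ((k : ℝ) + 1)) / √((k : ℝ) + 1)
      ≤ 1 / ((k : ℝ) + 1) / √((k : ℝ) + 1) := by
        gcongr
        exact deriv_logPsi_le (by positivity)
    _ = ((k : ℝ) + 1) ^ (-(1 + 1 / 2) : ℝ) := by
        rw [neg_add, rpow_add hk, rpow_neg_one, rpow_neg hk.le, ← sqrt_eq_rpow, one_div,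
          div_eq_mul_inv]

theorem tendsto_natCast_add_one_mul_logPsi :
    Tendsto (fun n : ℕ => ((n : ℝ) + 1) * logPsi (1 / ((n : ℝ) + 1))) atTop (𝓝 0) := by
  refine squeeze_zero (fun n => mul_nonneg (by positivity) (logPsi_nonneg _)) (fun n => ?_)
    tendsto_one_div_add_atTop_nhds_zero_nat
  calc ((n : ℝ) + 1) * logPsi (1 / ((n : ℝ) + 1)) ≤ ((n : ℝ) + 1) * (1 / ((n : ℝ) + 1)) ^ 2 := by
        gcongr
        exact logPsi_le_sq (by positivity)
    _ = 1 / ((n : ℝ) + 1) := by field_simp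

theorem tendsto_characteristic {f : ℝ → ℝ} {x : ℝ} (hf : MemLPsi logPsi f)
    (hx : IsLPsiPoint logPsi f x) :
    Tendsto (fun n : ℕ => characteristic logPsi f n x) atTop (𝓝 0) := by
  obtain ⟨M, hM⟩ := hx.exists_integral_div_le hf
  have hsum := tendsto_sum_mul_comp_div (e := fun u => logPsi (pointModulus logPsi f x u)) pi_pos
    summable_deriv_logPsi_div_sqrt (M := M)
    (fun u hu => by
      rw [abs_of_nonneg (logPsi_nonneg _), logPsi_pointModulus f x hu.1.le]
      exact hM u hu)
    ((hx.tendsto_integral_div hf).congr' <| by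
      filter_upwards [self_mem_nhdsWithin] with u hu
      rw [logPsi_pointModulus f x hu.le])
  have hlast := tendsto_natCast_add_one_mul_logPsi.mul_const (logPsi (pointModulus logPsi f x π))
  simpa only [characteristic, zero_mul, add_zero] using hsum.add hlast

end Characteristic

section StrongMean

theorem tendsto_average_of_forall_le_add {a : ℕ → ℝ} (ha : ∀ ν, 0 ≤ a ν)
    (hsplit : ∀ ε > 0, ∃ b c : ℕ → ℝ, (∀ ν, a ν ≤ b ν + c ν) ∧
      (∀ n : ℕ, ∑ ν ∈ Finset.range (n + 1), b ν ≤ ((n : ℝ) + 1) * ε) ∧ Tendsto c atTop (𝓝 0)) :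
    Tendsto (fun n : ℕ => 1 / ((n : ℝ) + 1) * ∑ ν ∈ Finset.range (n + 1), a ν) atTop (𝓝 0) := by
  refine Metric.tendsto_nhds.2 fun ε hε => ?_
  obtain ⟨b, c, habc, hb, hc⟩ := hsplit (ε / 2) (half_pos hε)
  filter_upwards [(hc.cesaro.comp (tendsto_add_atTop_nat 1)).eventually_lt_const (half_pos hε)]
    with n hn
  rw [Function.comp_apply, Nat.cast_add_one, inv_eq_one_div] at hn
  rw [dist_zero_right, norm_of_nonneg (mul_nonneg (by positivity)
    (Finset.sum_nonneg fun ν _ => ha ν))]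
  calc 1 / ((n : ℝ) + 1) * ∑ ν ∈ Finset.range (n + 1), a ν
      ≤ 1 / ((n : ℝ) + 1) * ∑ ν ∈ Finset.range (n + 1), (b ν + c ν) := by
        gcongr with ν _
        exact habc ν
    _ = 1 / ((n : ℝ) + 1) * ∑ ν ∈ Finset.range (n + 1), b ν +
          1 / ((n : ℝ) + 1) * ∑ ν ∈ Finset.range (n + 1), c ν := by
        rw [Finset.sum_add_distrib, mul_add]
    _ < 1 / ((n : ℝ) + 1) * (((n : ℝ) + 1) * (ε / 2)) + ε / 2 := by
        refine add_lt_add_of_le_of_lt ?_ hn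
        gcongr
        exact hb n
    _ = ε := by
        field_simp
        ring

theorem sum_expPhi_integral_le_of_le {φ : ℝ → ℝ} {δ τ : ℝ} {N : ℕ} (hN : 0 < N)
    (hφ : ∀ a b, IntervalIntegrable φ volume a b)
    (hψ : ∀ a b, IntervalIntegrable (fun t => logPsi |φ t|) volume a b)
    (hδ : δ ∈ Set.Ioc 0 π) (hτ : 0 < τ) (hsmall : 13400 * τ ≤ 1 / 36)
    (h : ∀ u ∈ Set.Icc 0 δ, ∫ t in (0 : ℝ)..u, logPsi |φ t| ≤ τ ^ 2 * u) :
    ∑ ν ∈ Finset.range N, expPhi |∫ t in (0 : ℝ)..δ, φ t * dirichletKernel ν t| ≤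
      N * (217 * (13400 * τ)) := by
  have hlogPsi : ∀ t, logPsi |(Set.Iic δ).indicator φ t| =
      (Set.Iic δ).indicator (fun t => logPsi |φ t|) t := fun t =>
    (congrFun (Set.indicator_comp_of_zero (g := fun y => logPsi |y|) (by simp)) t).symm
  have hkernel : ∀ ν, ∫ t in (0 : ℝ)..δ, φ t * dirichletKernel ν t =
      ∫ t in (0 : ℝ)..π, (Set.Iic δ).indicator φ t * dirichletKernel ν t := fun ν => by
    simp_rw [← Set.indicator_mul_left _ _ (dirichletKernel ν)]
    exact (intervalIntegral.integral_indicator (Set.Ioc_subset_Icc_self hδ)).symm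
  simp only [hkernel]
  refine sum_expPhi_integral_le hN (fun a b => ?_) (fun a b => ?_) hτ hsmall fun u hu => ?_
  · exact intervalIntegrable_iff.2 ((intervalIntegrable_iff.1 (hφ a b)).indicator measurableSet_Iic)
  · simp only [hlogPsi]
    exact intervalIntegrable_iff.2 ((intervalIntegrable_iff.1 (hψ a b)).indicator measurableSet_Iic)
  simp only [hlogPsi]
  rcases le_total u δ with huδ | hδu
  · refine le_of_eq_of_le (intervalIntegral.integral_congr fun t ht => ?_) (h u ⟨hu, huδ⟩)
    rw [Set.uIcc_of_le hu] at ht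
    exact Set.indicator_of_mem (s := Set.Iic δ) (ht.2.trans huδ) (fun t => logPsi |φ t|)
  · calc ∫ t in (0 : ℝ)..u, (Set.Iic δ).indicator (fun t => logPsi |φ t|) t
      _ = ∫ t in (0 : ℝ)..δ, logPsi |φ t| :=
          intervalIntegral.integral_indicator ⟨hδ.1.le, hδu⟩
      _ ≤ τ ^ 2 * δ := h δ ⟨hδ.1.le, le_rfl⟩
      _ ≤ τ ^ 2 * u := by gcongr

theorem expPhi_abs_partialSum_sub_le {f : ℝ → ℝ} (hper : Function.Periodic f (2 * π))
    (hf : ∀ a b, IntervalIntegrable f volume a b) (δ x : ℝ) (ν : ℕ) :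
    expPhi |partialSum f ν x - f x| ≤
      expPhi |∫ t in (0 : ℝ)..δ, symmDiff₂ f x t * dirichletKernel ν t| / 2 +
        expPhi |∫ t in δ..π, symmDiff₂ f x t * dirichletKernel ν t| / 2 := by
  have hint : ∀ a b, IntervalIntegrable (fun t => symmDiff₂ f x t * dirichletKernel ν t)
      volume a b := fun a b =>
    (intervalIntegrable_symmDiff₂ hf x a b).mul_continuousOn (by fun_prop)
  have hscale : ∀ y : ℝ, expPhi (2 * |1 / π * y|) ≤ expPhi |y| := fun y => by
    refine monotoneOn_expPhi (Set.mem_Ici.2 (by positivity)) (abs_nonneg y) ?_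
    rw [abs_mul, abs_of_pos (one_div_pos.2 pi_pos), ← mul_assoc, mul_one_div]
    exact mul_le_of_le_one_left (abs_nonneg y) ((div_le_one pi_pos).2 two_le_pi)
  rw [partialSum_sub_eq_integral hper hf,
    ← intervalIntegral.integral_add_adjacent_intervals (hint 0 δ) (hint δ π), mul_add, ← add_div]
  refine (expPhi_abs_add_le _ _).trans ?_
  gcongr <;> exact hscale _

theorem tendsto_strongMean {f : ℝ → ℝ} {x : ℝ} (hf : MemLPsi logPsi f)
    (hx : IsLPsiPoint logPsi f x) :
    Tendsto (fun n : ℕ => strongMean expPhi f n x) atTop (𝓝 0) := by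
  refine tendsto_nInv monotoneOn_expPhi (fun _ => expPhi_pos) surjOn_expPhi
    (fun n => mul_nonneg (by positivity) (Finset.sum_nonneg fun _ _ => expPhi_nonneg _))
    (tendsto_average_of_forall_le_add (fun _ => expPhi_nonneg _) fun ε hε => ?_)
  obtain ⟨τ, hτ, hsmall, hτε⟩ : ∃ τ > 0, 13400 * τ ≤ 1 / 36 ∧ 217 * (13400 * τ) ≤ ε :=
    ⟨min (1 / 36) (ε / 217) / 13400, by positivity,
      by linarith [min_le_left (1 / 36) (ε / 217)], by linarith [min_le_right (1 / 36) (ε / 217)]⟩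
  obtain ⟨δ, hδ, hδτ⟩ := hx.exists_integral_le hf (pow_pos hτ 2)
  have hφ := intervalIntegrable_symmDiff₂ hf.intervalIntegrable x
  refine ⟨_, _, expPhi_abs_partialSum_sub_le hf.periodic hf.intervalIntegrable δ x,
    fun n => ?_, ?_⟩
  · have hnear := sum_expPhi_integral_le_of_le n.succ_pos hφ
      (hf.intervalIntegrable_logPsi_symmDiff₂ x) hδ hτ hsmall hδτ
    rw [Nat.cast_succ] at hnear
    rw [← Finset.sum_div]
    have : ((n : ℝ) + 1) * (217 * (13400 * τ)) ≤ ((n : ℝ) + 1) * ε := by gcongr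
    have : 0 < ((n : ℝ) + 1) * ε := by positivity
    linarith
  · have hfar := (((continuous_expPhi.comp continuous_abs).tendsto 0).comp
      (tendsto_integral_mul_dirichletKernel hδ.1 hδ.2 (hφ δ π))).div_const 2
    simpa only [Function.comp_apply, abs_zero, expPhi_zero, zero_div] using hfar

end StrongMean

section AlmostEverywhere

variable {f : ℝ → ℝ}

theorem MemLPsi.locallyIntegrable_logPsi_sub_const (hf : MemLPsi logPsi f) (r : ℝ) :
    LocallyIntegrable (fun t => logPsi |f t - r|) := fun x => by
  refine ⟨Set.Icc (x - 1) (x + 1), Icc_mem_nhds (by linarith) (by linarith), ?_⟩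
  exact (intervalIntegrable_iff_integrableOn_Icc_of_le (by linarith)).1
    (hf.intervalIntegrable_logPsi_sub_const r _ _)

theorem tendsto_integral_sub_add_div {g : ℝ → ℝ} {x L : ℝ}
    (hg : ∀ a b, IntervalIntegrable g volume a b)
    (hderiv : HasDerivAt (fun y => ∫ t in x..y, g t) L x) :
    Tendsto (fun u => (∫ t in (x - u)..(x + u), g t) / u) (𝓝[>] 0) (𝓝 (2 * L)) := by
  have hadd : HasDerivAt (fun u => ∫ t in x..(x + u), g t) L 0 :=
    HasDerivAt.comp_const_add x 0 (by rwa [add_zero])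
  have hsub : HasDerivAt (fun u => ∫ t in x..(x - u), g t) (-L) 0 :=
    HasDerivAt.comp_const_sub x 0 (by rwa [sub_zero])
  have hslope := (hadd.sub hsub).tendsto_slope_zero_right
  rw [sub_neg_eq_add, ← two_mul] at hslope
  refine hslope.congr fun u => ?_
  simp only [Pi.sub_apply, zero_add, add_zero, sub_zero, intervalIntegral.integral_same,
    smul_eq_mul, intervalIntegral.integral_interval_sub_left (hg _ _) (hg _ _)]
  rw [div_eq_inv_mul]

theorem logPsi_symmDiff₂_le (f : ℝ → ℝ) (r x t : ℝ) :
    logPsi |symmDiff₂ f x t| ≤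
      4 * (logPsi |f (x + t) - r| + logPsi |f (x - t) - r| + logPsi |2 * (r - f x)|) := by
  have houter := logPsi_abs_add_le (f (x + t) - r) ((f (x - t) - r) + 2 * (r - f x))
  have hinner := logPsi_abs_add_le (f (x - t) - r) (2 * (r - f x))
  rw [show f (x + t) - r + (f (x - t) - r + 2 * (r - f x)) = symmDiff₂ f x t by
    unfold symmDiff₂
    ring] at houter
  linarith [logPsi_nonneg |f (x + t) - r|]

theorem MemLPsi.integral_logPsi_symmDiff₂_le (hf : MemLPsi logPsi f) (r x : ℝ) {u : ℝ}
    (hu : 0 ≤ u) : ∫ t in (0 : ℝ)..u, logPsi |symmDiff₂ f x t| ≤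
      4 * ((∫ t in (x - u)..(x + u), logPsi |f t - r|) + u * logPsi |2 * (r - f x)|) := by
  have hΨ := hf.intervalIntegrable_logPsi_sub_const r
  have hadd := intervalIntegrable_comp_const_add hΨ x 0 u
  have hsub := intervalIntegrable_comp_const_sub hΨ x 0 u
  refine (intervalIntegral.integral_mono_on hu (hf.intervalIntegrable_logPsi_symmDiff₂ x 0 u)
    (((hadd.add hsub).add intervalIntegrable_const).const_mul 4)
    fun t _ => logPsi_symmDiff₂_le f r x t).trans_eq ?_
  rw [intervalIntegral.integral_const_mul,
    intervalIntegral.integral_add (hadd.add hsub) intervalIntegrable_const,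
    intervalIntegral.integral_add hadd hsub, intervalIntegral.integral_const,
    intervalIntegral.integral_comp_add_left (fun t => logPsi |f t - r|),
    intervalIntegral.integral_comp_sub_left (fun t => logPsi |f t - r|), add_zero, sub_zero,
    sub_zero, smul_eq_mul, add_comm (∫ t in x..(x + u), _),
    intervalIntegral.integral_add_adjacent_intervals (hΨ _ _) (hΨ _ _)]

theorem exists_rat_logPsi_lt (y : ℝ) {ε : ℝ} (hε : 0 < ε) :
    ∃ r : ℚ, 4 * (2 * logPsi |y - r| + logPsi |2 * (r - y)|) < ε := by
  have hcont : Continuous fun r : ℝ => 4 * (2 * logPsi |y - r| + logPsi |2 * (r - y)|) := by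
    have := continuous_logPsi
    fun_prop
  exact Rat.denseRange_cast.exists_mem_open (isOpen_lt hcont continuous_const)
    ⟨y, by simpa using hε⟩

theorem MemLPsi.tendsto_integral_div_of_hasDerivAt (hf : MemLPsi logPsi f) {x : ℝ}
    (hx : ∀ r : ℚ, HasDerivAt (fun y => ∫ t in x..y, logPsi |f t - r|) (logPsi |f x - r|) x) :
    Tendsto (fun u => (∫ t in (0 : ℝ)..u, logPsi |symmDiff₂ f x t|) / u) (𝓝[>] 0) (𝓝 0) := by
  refine Metric.tendsto_nhds.2 fun ε hε => ?_
  obtain ⟨r, hr⟩ := exists_rat_logPsi_lt (f x) hε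
  have hlim := ((tendsto_integral_sub_add_div (hf.intervalIntegrable_logPsi_sub_const r)
    (hx r)).add_const (logPsi |2 * (r - f x)|)).const_mul 4
  filter_upwards [hlim.eventually_lt_const hr, self_mem_nhdsWithin] with u hlt hu
  have hu_pos : 0 < u := hu
  rw [dist_zero_right, norm_of_nonneg
    (div_nonneg (integral_logPsi_symmDiff₂_nonneg f x hu_pos.le) hu_pos.le)]
  refine lt_of_le_of_lt ?_ hlt
  rw [div_le_iff₀ hu_pos]
  refine (hf.integral_logPsi_symmDiff₂_le r x hu_pos.le).trans_eq ?_
  field_simp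

theorem ae_isLPsiPoint (hf : MemLPsi logPsi f) : ∀ᵐ x, IsLPsiPoint logPsi f x := by
  have hderiv : ∀ᵐ x, ∀ r : ℚ, ∀ c, HasDerivAt (fun y => ∫ t in c..y, logPsi |f t - r|)
      (logPsi |f x - r|) x :=
    ae_all_iff.2 fun r =>
      LocallyIntegrable.ae_hasDerivAt_integral (hf.locallyIntegrable_logPsi_sub_const r)
  filter_upwards [hderiv] with x hx
  refine tendsto_nInv monotoneOn_logPsi (fun _ => logPsi_pos) surjOn_logPsi
    (fun n => mul_nonneg (by positivity) (integral_logPsi_symmDiff₂_nonneg f x (by positivity)))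
    (((hf.tendsto_integral_div_of_hasDerivAt fun r => hx r x).comp
      (tendsto_div_natCast_add_one_nhdsGT_zero pi_pos)).congr fun n => ?_)
  rw [Function.comp_apply, one_div_mul_eq_div]

end AlmostEverywhere

end StrongApprox

theorem corollary1 (f : ℝ → ℝ) (hf : StrongApprox.MemLPsi StrongApprox.logPsi f) :
    (∀ x : ℝ, StrongApprox.IsLPsiPoint StrongApprox.logPsi f x →
        Tendsto (fun n : ℕ => StrongApprox.characteristic StrongApprox.logPsi f n x)
          atTop (𝓝 0)) ∧
      (∀ x : ℝ, StrongApprox.IsLPsiPoint StrongApprox.logPsi f x →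
        Tendsto (fun n : ℕ => StrongApprox.strongMean StrongApprox.expPhi f n x)
          atTop (𝓝 0)) ∧
      (∀ᵐ x ∂(volume : Measure ℝ), StrongApprox.IsLPsiPoint StrongApprox.logPsi f x) ∧
      (∀ᵐ x ∂(volume : Measure ℝ),
        Tendsto (fun n : ℕ => StrongApprox.characteristic StrongApprox.logPsi f n x)
          atTop (𝓝 0)) ∧
      (∀ᵐ x ∂(volume : Measure ℝ),
        Tendsto (fun n : ℕ => StrongApprox.strongMean StrongApprox.expPhi f n x)
          atTop (𝓝 0)) :=
  ⟨fun _ hx => StrongApprox.tendsto_characteristic hf hx,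
    fun _ hx => StrongApprox.tendsto_strongMean hf hx,
    StrongApprox.ae_isLPsiPoint hf,
    (StrongApprox.ae_isLPsiPoint hf).mono fun _ hx => StrongApprox.tendsto_characteristic hf hx,
    (StrongApprox.ae_isLPsiPoint hf).mono fun _ hx => StrongApprox.tendsto_strongMean hf hx⟩
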